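/- Let $q$ be a prime power, $k,h\ge 1$, and let $V$ be a $kh$-dimensional vector space over $\mathbb F_{q^h}$, so that $\mathrm{PG}(V)=\mathrm{PG}(kh-1,q^h)$. Let $\psi$ be a collineation of $\mathrm{PG}(V)$ induced by an injective map $V\to V$ that is semilinear with respect to $a\mapsto a^q$, and suppose that the $\mathbb F_q$-space of the vectors fixed by this map has dimension $kh$; let $\Pi\simeq\mathrm{PG}(kh-1,q)$ be the corresponding subgeometry $\mathrm{Fix}(\psi)$ of $\mathrm{PG}(V)$. Fix homogeneous coordinates $(x_{ij})_{1\le i\le k,\,1\le j\le h}$ on $\Pi$. They are also homogeneous coordinates on $\mathrm{PG}(V)$. Let $\mathcal S_{k-1,h-1}(q)$ be the Segre variety of the points of $\Pi$ with coordinates $(x_iy_j)$, where $x\in\mathbb F_q^k\setminus\{0\}$ and $y\in\mathbb F_q^h\setminus\{0\}$. Let $\mathcal R_{h,q}$ be its $(h-1)$-regulus, that is, the set of the $(h-1)$-dimensional subspaces obtained by fixing $x$ and letting $y$ vary. Let $\mathcal S_{k-1,h-1}(q^h)$ be the extension of the Segre variety, that is, the set of the points of $\mathrm{PG}(V)$ with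 coordinates $(x_iy_j)$, where $x\in\mathbb F_{q^h}^k\setminus\{0\}$ and $y\in\mathbb F_{q^h}^h\setminus\{0\}$. For a point $P$ of $\mathrm{PG}(V)$ put $X(P)=\langle P,P^\psi,\dots,P^{\psi^{h-1}}\rangle_{q^h}\cap\Pi$. For a $(k-1)$-dimensional subspace $\Theta$ of $\mathrm{PG}(V)$ such that $\Theta,\Theta^\psi,\dots,\Theta^{\psi^{h-1}}$ span $\mathrm{PG}(V)$, put $\mathcal L(\Theta)=\{X(P): P\in\Theta\}$. An $(h-1)$-spread of $\Pi$ is a set of $(h-1)$-dimensional subspaces of $\Pi$ such that every point of $\Pi$ lies in exactly one of them; it is called Desarguesian if it is the image of some such $\mathcal L(\Phi)$ under an element of $\mathrm{PGL}(kh,q)$. Let $\Xi$ be an $(h-1)$-dimensional subspace of $\Pi$ disjoint from $\mathcal S_{k-1,h-1}(q)$, and let $\overline\Xi$ be its extension to $\mathrm{PG}(V)$. Let $\Theta$ be a $(k-1)$-dimensional subspace of $\mathrm{PG}(V)$ such that $\Theta,\Theta^\psi,\dots,\Theta^{\psi^{h-1}}$ span $\mathrm{PG}(V)$, and suppose that $\Xi\in\mathcal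 L(\Theta)$ and $\mathcal R_{h,q}\subseteq\mathcal L(\Theta)$. Then $\Theta\cap\overline\Xi$ is a single point $P$, and $\mathcal L(\Theta)$ is the unique Desarguesian $(h-1)$-spread of $\Pi$ containing $\Xi$ and $\mathcal R_{h,q}$ if and only if $$\overline\Xi\cap\mathcal S_{k-1,h-1}(q^h)=\{P,P^\psi,\dots,P^{\psi^{h-1}}\}.$$ -/

import Mathlib

open Module
open scoped LinearAlgebra.Projectivization

namespace DesarguesianSpread

/-! ### Segre varieties

A family `b` indexed by `Fin k × Fin h` (in practice a basis) provides homogeneous coordinates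
`x_{ij}` on `PG(W)`, where `W` is a vector space over the field `E`. -/

section Segre

variable {E W : Type*} [Field E] [AddCommGroup W] [Module E W] {k h : ℕ}

/-- The vector with coordinates `x_i y_j` with respect to `b`. -/
def segreVector (b : Fin k × Fin h → W) (x : Fin k → E) (y : Fin h → E) : W :=
  ∑ ij : Fin k × Fin h, (x ij.1 * y ij.2) • b ij

variable (E) in
/-- The Segre variety `S_{k-1,h-1}(E)`: the set of the points of `PG(W)` of the form `(x_i y_j)`. -/
def segreVariety (b : Fin k × Fin h → W) : Set (ℙ E W) :=
  {Q | ∃ (x : Fin k → E) (y : Fin h → E) (hxy : segreVector b x y ≠ 0),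
    Q = Projectivization.mk E (segreVector b x y) hxy}

variable (E) in
/-- The `(h-1)`-regulus of the Segre variety: its members are the subspaces obtained by fixing
a point `x` of `PG(k-1,E)` and letting `y` vary. -/
def segreRegulus (b : Fin k × Fin h → W) : Set (Submodule E W) :=
  {X | ∃ x : Fin k → E, x ≠ 0 ∧ (X : Set W) = Set.range fun y : Fin h → E => segreVector b x y}

end Segre

/-- An `(h-1)`-spread of `PG(W)`: a set of `(h-1)`-dimensional projective subspaces such that every
point lies in exactly one of them. -/
def IsSpread {E W : Type*} [Field E] [AddCommGroup W] [Module E W] (h : ℕ)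
    (D : Set (Submodule E W)) : Prop :=
  (∀ X ∈ D, finrank E X = h) ∧ ∀ x : ℙ E W, ∃! X, X ∈ D ∧ x.submodule ≤ X

section Desarguesian

variable (F K : Type*) [Field F] [Fintype F] [Field K] [Algebra F K]

/-- The automorphism `a ↦ a ^ q` of `K`, where `q = |F|`, as a ring homomorphism. -/
abbrev frob : K →+* K := (FiniteField.frobeniusAlgHom F K).toRingHom

variable {F K} {V : Type*} [AddCommGroup V] [Module F V] [Module K V] [IsScalarTower F K V]

/-- The `F`-space of the vectors fixed by the semilinear map `Ψ`. Its projective space is the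
subgeometry `Π = Fix(Ψ)`. -/
def fixedSpace (Ψ : V →ₛₗ[frob F K] V) : Submodule F V where
  carrier := {x | Ψ x = x}
  zero_mem' := map_zero Ψ
  add_mem' := by
    intro x y hx hy
    simp only [Set.mem_ofPred_eq] at hx hy ⊢
    rw [map_add, hx, hy]
  smul_mem' := by
    intro c x hx
    simp only [Set.mem_ofPred_eq] at hx ⊢
    rw [← algebraMap_smul K c x, LinearMap.map_smulₛₗ, hx]
    congr 1
    exact (FiniteField.frobeniusAlgHom F K).commutes c

/-- The extension over `K` of a subspace of `Π`. -/
def extension (Ψ : V →ₛₗ[frob F K] V) (X : Submodule F (fixedSpace Ψ)) : Submodule K V :=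
  Submodule.span K ((fun x : fixedSpace Ψ => (x : V)) '' (X : Set (fixedSpace Ψ)))

/-- The conjugate `P ^ (Ψ ^ i)` of a point `P` of `PG(V)`. -/
def conjPoint (Ψ : V →ₛₗ[frob F K] V) (hΨ : Function.Injective Ψ) (i : ℕ) (P : ℙ K V) : ℙ K V :=
  (Projectivization.map Ψ hΨ)^[i] P

/-- The conjugate `Θ ^ (Ψ ^ i)` of a subspace `Θ` of `PG(V)`. -/
def conjSubspace (Ψ : V →ₛₗ[frob F K] V) (i : ℕ) (Θ : Submodule K V) : Submodule K V :=
  Submodule.span K (Ψ^[i] '' (Θ : Set V))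

/-- `X*(P) = ⟨P, P^Ψ, …, P^(Ψ^(h-1))⟩`. -/
def orbitSpan (Ψ : V →ₛₗ[frob F K] V) (hΨ : Function.Injective Ψ) (h : ℕ) (P : ℙ K V) :
    Submodule K V :=
  ⨆ i : Fin h, (conjPoint Ψ hΨ i P).submodule

/-- `X(P) = X*(P) ∩ Π`, as a subspace of `Π`. -/
def spreadElement (Ψ : V →ₛₗ[frob F K] V) (hΨ : Function.Injective Ψ) (h : ℕ) (P : ℙ K V) :
    Submodule F (fixedSpace Ψ) :=
  ((orbitSpan Ψ hΨ h P).restrictScalars F).comap (fixedSpace Ψ).subtype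

/-- `Θ` is a `(k-1)`-dimensional subspace of `PG(V)` that spans `PG(V)` together with its
conjugates `Θ^Ψ, …, Θ^(Ψ^(h-1))`. -/
def IsDirectorSpace (Ψ : V →ₛₗ[frob F K] V) (k h : ℕ) (Θ : Submodule K V) : Prop :=
  finrank K Θ = k ∧ ⨆ i : Fin h, conjSubspace Ψ i Θ = ⊤

/-- `L(Θ) = {X(P) : P ∈ Θ}`. -/
def spreadOf (Ψ : V →ₛₗ[frob F K] V) (hΨ : Function.Injective Ψ) (h : ℕ) (Θ : Submodule K V) :
    Set (Submodule F (fixedSpace Ψ)) :=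
  {X | ∃ P : ℙ K V, P.submodule ≤ Θ ∧ X = spreadElement Ψ hΨ h P}

/-- A Desarguesian `(h-1)`-spread of `Π ≃ PG(kh-1,q)`: an `(h-1)`-spread that is the image of some
`L(Φ)` under an element of `PGL(kh,q)`. -/
def IsDesarguesian (Ψ : V →ₛₗ[frob F K] V) (hΨ : Function.Injective Ψ) (k h : ℕ)
    (D : Set (Submodule F (fixedSpace Ψ))) : Prop :=
  IsSpread h D ∧ ∃ Φ : Submodule K V, IsDirectorSpace Ψ k h Φ ∧
    ∃ g : fixedSpace Ψ ≃ₗ[F] fixedSpace Ψ,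
      D = (fun X => X.map (g : fixedSpace Ψ →ₗ[F] fixedSpace Ψ)) '' spreadOf Ψ hΨ h Φ

end Desarguesian

end DesarguesianSpread

/-! Write x⊗y for the vector with coordinates x_i y_j, and σ for the Frobenius map of `K` over `F`.
By counting, `V` is the direct sum of the `h` conjugates of a director space Θ. Hence every fixed
vector is Σ Ψ^i θ for a unique θ in Θ, which makes L(Θ) a spread whose members extend to the spans
of the orbits (`IsDirectorSpace.isSpread`, `IsDirectorSpace.extension_spreadElement`).

The director spaces whose spread contains the regulus are exactly Θ_y = {x⊗y : x ∈ K^k} with the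
coordinates of y independent over `F` (`exists_eq_segreSpace`, `isDirectorSpace_segreSpace`,
`segreRegulus_subset`), and L(Θ_y) does not change when y is replaced by a nonzero multiple of a
conjugate (`spreadOf_segreSpace_conj`). Let Ξ = X(P) with P = x⊗y. Another such spread L(Θ_y')
through Ξ yields a Segre point x'⊗y' in the span of the orbit of P. If this span meets the variety
only in conjugates of P, then y' is a multiple of a conjugate of y, so the two spreads coincide.

Conversely, a further Segre point is a rank one combination Σ c_i σ^i(x)⊗σ^i(y) with two nonzero
coefficients. As the σ^i(y) form a basis of K^h, two conjugates of x are proportional, so x, scaled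
to have a coordinate 1, is fixed by some σ^m with 0 < m < h (`exists_frob_iterate_eq_smul`). It is
not rational, because Ξ misses the variety over `F`. So σ^m fixes an element other than 0 and 1, and
u ↦ σ^m(u)/u misses some e ≠ 0. Then y' = σ^m(y) - e y has independent coordinates and x⊗y' lies in
the span of the orbit of P, so L(Θ_y') is a second spread through Ξ and the regulus
(`exists_ne_spreadOf`). -/

namespace DesarguesianSpread

/-! ### Frobenius powers on a finite field extension -/

section Frobenius

variable {F K : Type*} [Field F] [Fintype F] [Field K] [Algebra F K]

theorem frob_iterate_eq_pow (i : ℕ) (a : K) :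
    (frob F K)^[i] a = (FiniteField.frobeniusAlgHom F K ^ i) a := by
  rw [AlgHom.coe_pow]
  rfl

theorem frob_iterate_algebraMap (i : ℕ) (c : F) :
    (frob F K)^[i] (algebraMap F K c) = algebraMap F K c := by
  rw [frob_iterate_eq_pow, AlgHom.commutes]

theorem frob_iterate_mul (i : ℕ) (a c : K) :
    (frob F K)^[i] (a * c) = (frob F K)^[i] a * (frob F K)^[i] c := by
  simp only [frob_iterate_eq_pow, map_mul]

theorem frob_iterate_sum {ι : Type*} (s : Finset ι) (i : ℕ) (f : ι → K) :
    (frob F K)^[i] (∑ j ∈ s, f j) = ∑ j ∈ s, (frob F K)^[i] (f j) := by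
  simp only [frob_iterate_eq_pow, map_sum]

theorem frob_iterate_eq_zero {i : ℕ} {a : K} : (frob F K)^[i] a = 0 ↔ a = 0 := by
  rw [frob_iterate_eq_pow, map_eq_zero]

variable [Finite K]

theorem frob_iterate_finrank (a : K) : (frob F K)^[finrank F K] a = a := by
  rw [frob_iterate_eq_pow, ← FiniteField.orderOf_frobeniusAlgHom F K, pow_orderOf_eq_one]
  rfl

theorem frob_iterate_surjective (i : ℕ) : Function.Surjective ((frob F K)^[i]) :=
  (Finite.surjective_of_injective (frob F K).injective).iterate i

/-- The Galois group consists of powers of Frobenius, so an element fixed by Frobenius lies in the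
base field. -/
theorem exists_algebraMap_eq_of_frob_eq {a : K} (ha : frob F K a = a) :
    ∃ c : F, algebraMap F K c = a := by
  have : FiniteDimensional F K := Module.Finite.of_finite
  have h : a ∈ (⊥ : IntermediateField F K) := by
    rw [IsGalois.mem_bot_iff_fixed]
    intro f
    obtain ⟨n, rfl⟩ := (FiniteField.bijective_frobeniusAlgEquivOfAlgebraic_pow F K).2 f
    have h1 : ∀ m : ℕ, (FiniteField.frobeniusAlgEquivOfAlgebraic F K ^ m) a = a := by
      intro m
      induction m with
      | zero => rfl
      | succ m ih =>
        rw [pow_succ, AlgEquiv.mul_apply]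
        have : FiniteField.frobeniusAlgEquivOfAlgebraic F K a = a := ha
        rw [this, ih]
    exact h1 n
  simpa [IntermediateField.mem_bot] using h

theorem exists_frob_iterate_ne {m : ℕ} (hm : 0 < m) (hmh : m < finrank F K) :
    ∃ s : K, (frob F K)^[m] s ≠ s := by
  by_contra! hc
  have h1 : FiniteField.frobeniusAlgHom F K ^ m = 1 := by
    ext a
    rw [← frob_iterate_eq_pow, hc]
    rfl
  have h2 := orderOf_dvd_of_pow_eq_one h1
  rw [FiniteField.orderOf_frobeniusAlgHom] at h2
  exact absurd (Nat.le_of_dvd hm h2) (not_le.2 hmh)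

/-- If the coordinates of `y` are linearly independent over `F`, then so are, over `K`, the
conjugates of `y`. -/
theorem linearIndependent_conj {h : ℕ} (hK : finrank F K = h) {y : Fin h → K}
    (hy : LinearIndependent F y) :
    LinearIndependent K (fun (i : Fin h) (j : Fin h) => (frob F K)^[i] (y j)) := by
  subst hK
  have : FiniteDimensional F K := Module.Finite.of_finite
  -- Dedekind: distinct powers of Frobenius are independent over `K`. A relation among the
  -- conjugates of `y` is a relation among these powers on the `F`-basis `y` of `K`.
  have hind := (linearIndependent_algHom_toLinearMap F K K).comp _
    (FiniteField.bijective_frobeniusAlgHom_pow F K).1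
  rw [Fintype.linearIndependent_iff] at hind ⊢
  intro g hg
  refine hind g ?_
  have hbasis : Submodule.span F (Set.range y) = ⊤ :=
    hy.span_eq_top_of_card_eq_finrank' (by simp)
  refine LinearMap.ext_on_range hbasis fun j => ?_
  have := congrFun hg j
  simpa [frob_iterate_eq_pow] using this

end Frobenius

/-! ### Iterates of the semilinear map -/

section Iterate

variable {F K V : Type*} [Field F] [Fintype F] [Field K] [Algebra F K]
  [AddCommGroup V] [Module K V] (Ψ : V →ₛₗ[frob F K] V)

theorem iterate_add (i : ℕ) (v w : V) : Ψ^[i] (v + w) = Ψ^[i] v + Ψ^[i] w :=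
  iterate_map_add Ψ i v w

theorem iterate_zero' (i : ℕ) : Ψ^[i] (0 : V) = 0 :=
  iterate_map_zero Ψ i

theorem iterate_smul (i : ℕ) (c : K) (v : V) :
    Ψ^[i] (c • v) = (frob F K)^[i] c • Ψ^[i] v := by
  induction i generalizing c v with
  | zero => rfl
  | succ i ih => rw [Function.iterate_succ_apply, LinearMap.map_smulₛₗ, ih]; rfl

theorem iterate_sum {ι : Type*} (s : Finset ι) (i : ℕ) (f : ι → V) :
    Ψ^[i] (∑ j ∈ s, f j) = ∑ j ∈ s, Ψ^[i] (f j) := by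
  classical
  induction s using Finset.induction_on with
  | empty => simpa using iterate_zero' Ψ i
  | insert a s ha ih => rw [Finset.sum_insert ha, Finset.sum_insert ha, iterate_add, ih]

end Iterate

/-! ### Fixed vectors and extension of scalars -/

section Fixed

variable {F K V : Type*} [Field F] [Fintype F] [Field K] [Algebra F K]
  [AddCommGroup V] [Module F V] [Module K V] [IsScalarTower F K V]
  (Ψ : V →ₛₗ[frob F K] V)

theorem iterate_fixed (i : ℕ) (w : fixedSpace Ψ) : Ψ^[i] (w : V) = w :=
  Function.iterate_fixed w.2 i

variable [Finite K]

/-- Fixed vectors that are independent over `F` are independent over `K`. -/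
theorem linearIndependent_coe {ι : Type*} {v : ι → fixedSpace Ψ} (hv : LinearIndependent F v) :
    LinearIndependent K (fun i => (v i : V)) := by
  classical
  rw [linearIndependent_iff']
  intro s
  induction s using Finset.induction_on with
  | empty => simp
  | insert i₀ s hi₀ ih =>
    intro g hg
    have hzero : g i₀ = 0 := by
      by_contra hne
      -- Normalize one coefficient to 1. Subtracting the relation from its image under `Ψ` removes
      -- that term, so by induction all coefficients are fixed by Frobenius and the relation is
      -- defined over `F`.
      set a : ι → K := fun i => (g i₀)⁻¹ * g i with ha
      have ha₀ : a i₀ = 1 := inv_mul_cancel₀ hne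
      have hsum : ∑ i ∈ insert i₀ s, a i • (v i : V) = 0 := by
        simp only [ha, mul_smul, ← Finset.smul_sum, hg, smul_zero]
      have hΨ : ∑ i ∈ insert i₀ s, frob F K (a i) • (v i : V) = 0 := by
        have := congrArg Ψ hsum
        rw [map_sum, map_zero] at this
        rw [← this]
        refine Finset.sum_congr rfl fun i _ => ?_
        rw [LinearMap.map_smulₛₗ, show Ψ (v i : V) = v i from (v i).2]
      have hdiff : ∑ i ∈ s, (frob F K (a i) - a i) • (v i : V) = 0 := by
        have := hΨ.trans hsum.symm
        rw [Finset.sum_insert hi₀, Finset.sum_insert hi₀, ha₀, map_one] at this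
        simp only [sub_smul, Finset.sum_sub_distrib]
        exact sub_eq_zero.2 (add_left_cancel this)
      have hfix : ∀ i ∈ insert i₀ s, ∃ c : F, algebraMap F K c = a i := by
        intro i hi
        rcases Finset.mem_insert.1 hi with rfl | hi
        · exact ⟨1, by rw [ha₀, map_one]⟩
        · exact exists_algebraMap_eq_of_frob_eq (sub_eq_zero.1 (ih _ hdiff i hi))
      choose! c hc using hfix
      have hF : ∑ i ∈ insert i₀ s, c i • v i = 0 := by
        apply Subtype.ext
        rw [Submodule.coe_sum, Submodule.coe_zero, ← hsum]
        refine Finset.sum_congr rfl fun i hi => ?_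
        rw [Submodule.coe_smul, ← algebraMap_smul K, hc i hi]
      have hc₀ := linearIndependent_iff'.1 hv _ c hF i₀ (Finset.mem_insert_self _ _)
      have := hc i₀ (Finset.mem_insert_self _ _)
      rw [hc₀, ha₀, map_zero] at this
      exact zero_ne_one this
    rw [Finset.sum_insert hi₀, hzero, zero_smul, zero_add] at hg
    intro i hi
    rcases Finset.mem_insert.1 hi with rfl | hi
    · exact hzero
    · exact ih g hg i hi

theorem finrank_extension [Module.Finite F (fixedSpace Ψ)] (X : Submodule F (fixedSpace Ψ)) :
    finrank K (extension Ψ X) = finrank F X := by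
  let β := Module.finBasis F X
  have hind : LinearIndependent F (fun i => (β i : fixedSpace Ψ)) :=
    β.linearIndependent.map' X.subtype (Submodule.ker_subtype X)
  have hK := linearIndependent_coe Ψ hind
  have hspan : extension Ψ X = Submodule.span K (Set.range fun i => ((β i : fixedSpace Ψ) : V)) := by
    apply le_antisymm
    · rw [extension, Submodule.span_le]
      rintro _ ⟨x, hx, rfl⟩
      have hx' : x = ∑ i, β.repr ⟨x, hx⟩ i • (β i : fixedSpace Ψ) := by
        conv_lhs => rw [← Subtype.coe_mk (p := (· ∈ X)) x hx, ← β.sum_repr ⟨x, hx⟩,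
          Submodule.coe_sum]
        rfl
      rw [SetLike.mem_coe, hx']
      simp only [Submodule.coe_sum, Submodule.coe_smul]
      refine Submodule.sum_mem _ fun i _ => ?_
      rw [← algebraMap_smul K]
      exact Submodule.smul_mem _ _ (Submodule.subset_span ⟨i, rfl⟩)
    · rw [Submodule.span_le]
      rintro _ ⟨i, rfl⟩
      exact Submodule.subset_span ⟨β i, (β i).2, rfl⟩
  rw [hspan, finrank_span_eq_card hK, Fintype.card_fin]

end Fixed

/-! ### Orbits of points and their spans -/

section Orbit

variable {F K V : Type*} [Field F] [Fintype F] [Field K] [Algebra F K]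
  [AddCommGroup V] [Module K V] (Ψ : V →ₛₗ[frob F K] V)
  (hΨ : Function.Injective Ψ)

theorem iterate_ne_zero {i : ℕ} {v : V} (hinj : Function.Injective Ψ) (hv : v ≠ 0) :
    Ψ^[i] v ≠ 0 := by
  rw [← iterate_zero' Ψ i]
  exact fun h => hv (hinj.iterate i h)

theorem conjPoint_mk (i : ℕ) (v : V) (hv : v ≠ 0) :
    conjPoint Ψ hΨ i (Projectivization.mk K v hv) =
      Projectivization.mk K (Ψ^[i] v) (iterate_ne_zero Ψ hΨ hv) := by
  induction i with
  | zero => rfl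
  | succ i ih =>
    have h1 := congrArg (Projectivization.map Ψ hΨ) ih
    rw [conjPoint, ← Function.iterate_succ_apply' (Projectivization.map Ψ hΨ)] at h1
    rw [conjPoint, h1, Projectivization.map_mk]
    simp only [Function.iterate_succ_apply']

theorem orbitSpan_mk (h : ℕ) (v : V) (hv : v ≠ 0) :
    orbitSpan Ψ hΨ h (Projectivization.mk K v hv) =
      Submodule.span K (Set.range fun i : Fin h => Ψ^[i] v) := by
  simp only [orbitSpan, conjPoint_mk, Projectivization.submodule_mk]
  rw [Submodule.span_range_eq_iSup]

variable {Ψ} in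
theorem conjPoint_mul {h : ℕ} (hper : ∀ v, Ψ^[h] v = v) (n : ℕ) (P : ℙ K V) :
    conjPoint Ψ hΨ (h * n) P = P := by
  induction P using Projectivization.ind with
  | _ v hv =>
    rw [conjPoint_mk]
    congr 1
    rw [Function.iterate_mul]
    exact Function.iterate_fixed (hper v) n

variable {Ψ} in
theorem conjPoint_le_orbitSpan {h : ℕ} (hh : 0 < h) (hper : ∀ v, Ψ^[h] v = v) (n : ℕ)
    (P : ℙ K V) : (conjPoint Ψ hΨ n P).submodule ≤ orbitSpan Ψ hΨ h P := by
  have h1 : conjPoint Ψ hΨ n P = conjPoint Ψ hΨ (n % h) P := by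
    conv_lhs => rw [← Nat.mod_add_div n h]
    conv_lhs => rw [conjPoint, Function.iterate_add_apply]
    have := conjPoint_mul hΨ hper (n / h) P
    rw [conjPoint] at this
    rw [this]
    rfl
  rw [h1]
  exact le_iSup (fun i : Fin h => (conjPoint Ψ hΨ i P).submodule) ⟨n % h, Nat.mod_lt _ hh⟩

variable {Ψ} in
theorem orbitSpan_conjPoint {h : ℕ} (hh : 0 < h) (hper : ∀ v, Ψ^[h] v = v) (n : ℕ)
    (P : ℙ K V) : orbitSpan Ψ hΨ h (conjPoint Ψ hΨ n P) = orbitSpan Ψ hΨ h P := by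
  have key : ∀ (m : ℕ) (Q : ℙ K V),
      orbitSpan Ψ hΨ h (conjPoint Ψ hΨ m Q) ≤ orbitSpan Ψ hΨ h Q := by
    intro m Q
    refine iSup_le fun i => ?_
    rw [conjPoint, conjPoint, ← Function.iterate_add_apply]
    exact conjPoint_le_orbitSpan hΨ hh hper _ Q
  refine le_antisymm (key n P) ?_
  -- Another `n * (h - 1)` steps complete `n` full periods, so `P` is itself a conjugate of its
  -- conjugate.
  have h1 : conjPoint Ψ hΨ (n * (h - 1)) (conjPoint Ψ hΨ n P) = P := by
    have h2 : n * (h - 1) + n = h * n := by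
      obtain ⟨m, rfl⟩ := Nat.exists_eq_add_of_lt hh
      simp
      ring
    conv_lhs => rw [conjPoint, conjPoint, ← Function.iterate_add_apply, h2]
    exact conjPoint_mul hΨ hper n P
  conv_lhs => rw [← h1]
  exact key _ _

variable {Ψ} in
/-- The span of an orbit contains the span of the orbit of each of its points. -/
theorem orbitSpan_le {h : ℕ} (hh : 0 < h) (hper : ∀ v, Ψ^[h] v = v) {P Q : ℙ K V}
    (hQ : Q.submodule ≤ orbitSpan Ψ hΨ h P) : orbitSpan Ψ hΨ h Q ≤ orbitSpan Ψ hΨ h P := by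
  induction P using Projectivization.ind with
  | _ v hv =>
  induction Q using Projectivization.ind with
  | _ w hw =>
  -- The span of an orbit is stable under `Ψ`, so it contains the orbit of `w` once it contains `w`.
  have hstep : ∀ u ∈ orbitSpan Ψ hΨ h (Projectivization.mk K v hv),
      Ψ u ∈ orbitSpan Ψ hΨ h (Projectivization.mk K v hv) := by
    intro u hu
    rw [orbitSpan_mk, Submodule.mem_span_range_iff_exists_fun] at hu
    obtain ⟨c, rfl⟩ := hu
    rw [map_sum]
    refine Submodule.sum_mem _ fun i _ => ?_
    rw [LinearMap.map_smulₛₗ, ← Function.iterate_succ_apply' Ψ]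
    refine Submodule.smul_mem _ _ (conjPoint_le_orbitSpan hΨ hh hper (i + 1) _ ?_)
    rw [conjPoint_mk, Projectivization.submodule_mk]
    exact Submodule.mem_span_singleton_self _
  have hw' : w ∈ orbitSpan Ψ hΨ h (Projectivization.mk K v hv) :=
    hQ (by rw [Projectivization.submodule_mk]; exact Submodule.mem_span_singleton_self _)
  rw [orbitSpan_mk _ _ _ w hw, Submodule.span_le]
  rintro _ ⟨i, rfl⟩
  change Ψ^[(i : ℕ)] w ∈ orbitSpan Ψ hΨ h (Projectivization.mk K v hv)
  generalize (i : ℕ) = n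
  induction n with
  | zero => exact hw'
  | succ n ih =>
    rw [Function.iterate_succ_apply']
    exact hstep _ ih

variable {Ψ} in
theorem finrank_orbitSpan_le (h : ℕ) (P : ℙ K V) : finrank K (orbitSpan Ψ hΨ h P) ≤ h := by
  induction P using Projectivization.ind with
  | _ v hv =>
  rw [orbitSpan_mk]
  exact (finrank_range_le_card _).trans_eq (Fintype.card_fin h)

/-- The sum of the first `h` iterates of a vector. -/
def orbitSum (h : ℕ) (v : V) : V := ∑ i : Fin h, Ψ^[i] v

theorem orbitSum_add (h : ℕ) (v w : V) :
    orbitSum Ψ h (v + w) = orbitSum Ψ h v + orbitSum Ψ h w := by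
  simp only [orbitSum, iterate_add, Finset.sum_add_distrib]

variable {Ψ} in
-- `Ψ` permutes the summands cyclically, since its `h`-th iterate is the identity.
theorem map_orbitSum {h : ℕ} (hper : ∀ v, Ψ^[h] v = v) (v : V) :
    Ψ (orbitSum Ψ h v) = orbitSum Ψ h v := by
  have h1 := Finset.sum_range_succ (fun i => Ψ^[i] v) h
  rw [Finset.sum_range_succ', hper, Function.iterate_zero, id] at h1
  have h2 := add_right_cancel h1
  rw [Finset.sum_range, Finset.sum_range] at h2
  rw [orbitSum, map_sum, ← h2]
  exact Finset.sum_congr rfl fun i _ => (Function.iterate_succ_apply' Ψ i v).symm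

end Orbit

/-! ### Director spaces and their spreads -/

section Director

variable {F K V : Type*} [Field F] [Fintype F] [Field K] [Finite K] [Algebra F K]
  [AddCommGroup V] [Module K V] {Ψ : V →ₛₗ[frob F K] V}

/-- Frobenius is onto on a finite field, so the image of a subspace is already closed under scalars.
-/
theorem mem_conjSubspace {i : ℕ} {Θ : Submodule K V} {v : V} :
    v ∈ conjSubspace Ψ i Θ ↔ ∃ θ ∈ Θ, Ψ^[i] θ = v := by
  constructor
  · intro hv
    induction hv using Submodule.span_induction with
    | mem x hx => exact hx
    | zero => exact ⟨0, Θ.zero_mem, iterate_zero' Ψ i⟩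
    | add x y _ _ hx hy =>
      obtain ⟨a, ha, rfl⟩ := hx
      obtain ⟨b, hb, rfl⟩ := hy
      exact ⟨a + b, Θ.add_mem ha hb, iterate_add Ψ i a b⟩
    | smul c x _ hx =>
      obtain ⟨a, ha, rfl⟩ := hx
      obtain ⟨d, rfl⟩ := frob_iterate_surjective (F := F) i c
      exact ⟨d • a, Θ.smul_mem d ha, iterate_smul Ψ i d a⟩
  · rintro ⟨θ, hθ, rfl⟩
    exact Submodule.subset_span ⟨θ, hθ, rfl⟩

variable {k h : ℕ} {Θ : Submodule K V}

theorem IsDirectorSpace.exists_sum (hΘ : IsDirectorSpace Ψ k h Θ) (v : V) :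
    ∃ θ : Fin h → Θ, ∑ i : Fin h, Ψ^[i] (θ i : V) = v := by
  have hv : v ∈ ⨆ i : Fin h, conjSubspace Ψ i Θ := hΘ.2 ▸ Submodule.mem_top
  refine Submodule.iSup_induction _
    (motive := fun v => ∃ θ : Fin h → Θ, ∑ i : Fin h, Ψ^[i] (θ i : V) = v) hv ?_ ?_ ?_
  · intro i x hx
    obtain ⟨a, ha, rfl⟩ := mem_conjSubspace.1 hx
    refine ⟨Pi.single i ⟨a, ha⟩, ?_⟩
    rw [Finset.sum_eq_single i]
    · rw [Pi.single_eq_same]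
    · intro j _ hj
      rw [Pi.single_eq_of_ne hj]
      exact iterate_zero' Ψ j
    · simp
  · exact ⟨0, Finset.sum_eq_zero fun i _ => iterate_zero' Ψ i⟩
  · rintro x y ⟨a, rfl⟩ ⟨b, rfl⟩
    refine ⟨a + b, ?_⟩
    rw [← Finset.sum_add_distrib]
    exact Finset.sum_congr rfl fun i _ => iterate_add Ψ i _ _

variable [Module.Finite K V]

/-- A surjection between finite sets of equal size |K|^(kh) is injective; thus `V` is the direct sum
of the conjugates of `Θ`. -/
theorem IsDirectorSpace.injective_sum (hΘ : IsDirectorSpace Ψ k h Θ)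
    (hV : finrank K V = k * h) :
    Function.Injective (fun θ : Fin h → Θ => ∑ i : Fin h, Ψ^[i] (θ i : V)) := by
  have : Finite V := Module.finite_of_finite K
  have hcard : Nat.card (Fin h → Θ) = Nat.card V := by
    rw [Nat.card_fun, Nat.card_fin, Module.natCard_eq_pow_finrank (K := K) (V := Θ),
      Module.natCard_eq_pow_finrank (K := K) (V := V), hΘ.1, hV, pow_mul]
  exact ((Nat.bijective_iff_surjective_and_card _).2 ⟨hΘ.exists_sum, hcard⟩).1

theorem IsDirectorSpace.eq_of_sum_eq (hΘ : IsDirectorSpace Ψ k h Θ)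
    (hV : finrank K V = k * h) {θ θ' : Fin h → V} (hθ : ∀ i, θ i ∈ Θ) (hθ' : ∀ i, θ' i ∈ Θ)
    (heq : ∑ i : Fin h, Ψ^[i] (θ i) = ∑ i : Fin h, Ψ^[i] (θ' i)) : θ = θ' := by
  have := hΘ.injective_sum hV (a₁ := fun i => ⟨θ i, hθ i⟩) (a₂ := fun i => ⟨θ' i, hθ' i⟩) heq
  funext i
  exact congrArg Subtype.val (congrFun this i)

theorem IsDirectorSpace.orbitSum_inj (hh : 0 < h) (hΘ : IsDirectorSpace Ψ k h Θ)
    (hV : finrank K V = k * h) {v w : V} (hv : v ∈ Θ) (hw : w ∈ Θ)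
    (heq : orbitSum Ψ h v = orbitSum Ψ h w) : v = w :=
  congrFun (hΘ.eq_of_sum_eq hV (θ := fun _ => v) (θ' := fun _ => w) (fun _ => hv) (fun _ => hw)
    heq) ⟨0, hh⟩

/-- Applying `Ψ` shifts the components of a vector cyclically, so uniqueness of components makes
those of a fixed vector equal. -/
theorem IsDirectorSpace.eq_of_fixed (hΘ : IsDirectorSpace Ψ k h Θ)
    (hV : finrank K V = k * h) (hh : 0 < h) (hper : ∀ v, Ψ^[h] v = v) {θ : Fin h → V}
    (hθ : ∀ i, θ i ∈ Θ) (hfix : Ψ (∑ i : Fin h, Ψ^[i] (θ i)) = ∑ i : Fin h, Ψ^[i] (θ i)) :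
    ∀ i, θ i = θ ⟨0, hh⟩ := by
  obtain ⟨n, rfl⟩ : ∃ n, h = n + 1 := ⟨h - 1, by omega⟩
  -- Subtraction in `Fin (n + 1)` is cyclic: the last component moves to index 0 because `Ψ^[h]` is
  -- the identity.
  have hshift : θ = fun i => θ (i - 1) := by
    refine hΘ.eq_of_sum_eq hV hθ (fun i => hθ _) ?_
    rw [← hfix, map_sum, ← Equiv.sum_comp (Equiv.addRight (1 : Fin (n + 1)))
      (fun i => Ψ^[(i : ℕ)] (θ (i - 1)))]
    refine Finset.sum_congr rfl fun i _ => ?_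
    rw [← Function.iterate_succ_apply' Ψ, Equiv.coe_addRight, add_sub_cancel_right]
    rw [Fin.val_add, Fin.val_one', Nat.add_mod_mod]
    exact (Function.IsPeriodicPt.iterate_mod_apply (hper (θ i)) _).symm
  intro i
  induction i using Fin.induction with
  | zero => rfl
  | succ i ih =>
    rw [← ih]
    refine (congrFun hshift i.succ).trans (congrArg θ ?_)
    rw [sub_eq_iff_eq_add, Fin.coeSucc_eq_succ]

theorem IsDirectorSpace.mem_span_of_mem_orbitSpan (hΨ : Function.Injective Ψ) (hh : 0 < h)
    (hΘ : IsDirectorSpace Ψ k h Θ)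
    (hV : finrank K V = k * h) {θ v : V} (hθ₀ : θ ≠ 0) (hθ : θ ∈ Θ) (hv : v ∈ Θ)
    (hmem : v ∈ orbitSpan Ψ hΨ h (Projectivization.mk K θ hθ₀)) : ∃ c : K, v = c • θ := by
  rw [orbitSpan_mk, Submodule.mem_span_range_iff_exists_fun] at hmem
  obtain ⟨c, hc⟩ := hmem
  -- Extracting Frobenius roots of the coefficients brings them inside `Ψ^[i]`; the components at
  -- index 0 can then be compared.
  choose d hd using fun i : Fin h => frob_iterate_surjective (F := F) (i : ℕ) (c i)
  have heq : ∑ i : Fin h, Ψ^[i] (d i • θ) =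
      ∑ i : Fin h, Ψ^[i] (if i = ⟨0, hh⟩ then v else 0) := by
    rw [Finset.sum_eq_single (⟨0, hh⟩ : Fin h) (f := fun i : Fin h => Ψ^[i] (if i = _ then v else 0))]
    · simp only [iterate_smul, hd, hc, if_true, Function.iterate_zero, id]
    · intro i _ hi
      rw [if_neg hi, iterate_zero']
    · simp
  have := hΘ.eq_of_sum_eq hV (fun i => Θ.smul_mem _ hθ)
    (fun i => by split_ifs; exacts [hv, Θ.zero_mem]) heq
  exact ⟨d ⟨0, hh⟩, by simpa using (congrFun this ⟨0, hh⟩).symm⟩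

theorem IsDirectorSpace.submodule_eq_inf (hΨ : Function.Injective Ψ) (hh : 0 < h)
    (hper : ∀ v, Ψ^[h] v = v) (hΘ : IsDirectorSpace Ψ k h Θ)
    (hV : finrank K V = k * h) {P : ℙ K V} (hP : P.submodule ≤ Θ) :
    P.submodule = Θ ⊓ orbitSpan Ψ hΨ h P := by
  refine le_antisymm (le_inf hP (conjPoint_le_orbitSpan hΨ hh hper 0 P)) ?_
  induction P using Projectivization.ind with
  | _ θ hθ₀ =>
  rw [Projectivization.submodule_mk, Submodule.span_singleton_le_iff_mem] at hP
  rintro v ⟨hv, hv'⟩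
  obtain ⟨c, rfl⟩ := hΘ.mem_span_of_mem_orbitSpan hΨ hh hV hθ₀ hP hv hv'
  rw [Projectivization.submodule_mk]
  exact Submodule.smul_mem _ _ (Submodule.mem_span_singleton_self _)

variable [Module F V] [IsScalarTower F K V]

theorem IsDirectorSpace.exists_orbitSum_eq (hΘ : IsDirectorSpace Ψ k h Θ)
    (hV : finrank K V = k * h) (hh : 0 < h) (hper : ∀ v, Ψ^[h] v = v) (w : fixedSpace Ψ) :
    ∃ θ ∈ Θ, orbitSum Ψ h θ = w := by
  obtain ⟨θ, hθ⟩ := hΘ.exists_sum (w : V)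
  have h1 := hΘ.eq_of_fixed hV hh hper (fun i => (θ i).2) (by rw [hθ]; exact w.2)
  refine ⟨θ ⟨0, hh⟩, (θ _).2, ?_⟩
  rw [← hθ, orbitSum]
  exact Finset.sum_congr rfl fun i _ => by rw [h1 i]

/-- This parametrizes X(P) by `K` through a trace-like map, whose injectivity gives X(P) its
dimension `h` over `F`. -/
theorem IsDirectorSpace.mem_spreadElement (hΨ : Function.Injective Ψ)
    (hΘ : IsDirectorSpace Ψ k h Θ)
    (hV : finrank K V = k * h) (hh : 0 < h) (hper : ∀ v, Ψ^[h] v = v) {θ : V} (hθ₀ : θ ≠ 0)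
    (hθ : θ ∈ Θ) (w : fixedSpace Ψ) :
    w ∈ spreadElement Ψ hΨ h (Projectivization.mk K θ hθ₀) ↔
      ∃ c : K, orbitSum Ψ h (c • θ) = w := by
  have hiff : w ∈ spreadElement Ψ hΨ h (Projectivization.mk K θ hθ₀) ↔
      (w : V) ∈ orbitSpan Ψ hΨ h (Projectivization.mk K θ hθ₀) := Iff.rfl
  rw [hiff, orbitSpan_mk, Submodule.mem_span_range_iff_exists_fun]
  constructor
  · rintro ⟨c, hc⟩
    choose d hd using fun i : Fin h => frob_iterate_surjective (F := F) (i : ℕ) (c i)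
    have hw : ∑ i : Fin h, Ψ^[i] (d i • θ) = w := by
      simp only [iterate_smul, hd, hc]
    have h1 := hΘ.eq_of_fixed hV hh hper (fun i => Θ.smul_mem (d i) hθ) (by rw [hw]; exact w.2)
    refine ⟨d ⟨0, hh⟩, ?_⟩
    rw [← hw, orbitSum]
    exact Finset.sum_congr rfl fun i _ => by rw [h1 i]
  · rintro ⟨c, hc⟩
    exact ⟨fun i => (frob F K)^[i] c, by rw [← hc, orbitSum]; simp only [iterate_smul]⟩

variable (F h) in
/-- The map `c ↦ ∑ Ψ^i (c θ)` as an `F`-linear map into the fixed space. -/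
def orbitSumMap (hper : ∀ v, Ψ^[h] v = v) (θ : V) : K →ₗ[F] fixedSpace Ψ where
  toFun c := ⟨orbitSum Ψ h (c • θ), map_orbitSum hper _⟩
  map_add' a c := Subtype.ext (by
    simp only [add_smul, orbitSum_add, Submodule.coe_add])
  map_smul' a c := Subtype.ext (by
    rw [RingHom.id_apply, Submodule.coe_smul, ← algebraMap_smul K a (orbitSum Ψ h (c • θ)),
      Algebra.smul_def, mul_smul]
    simp only [orbitSum, iterate_smul, frob_iterate_algebraMap, Finset.smul_sum])

theorem IsDirectorSpace.finrank_spreadElement (hΨ : Function.Injective Ψ) (hK : finrank F K = h)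
    (hΘ : IsDirectorSpace Ψ k h Θ)
    (hV : finrank K V = k * h) (hh : 0 < h) (hper : ∀ v, Ψ^[h] v = v) {P : ℙ K V}
    (hP : P.submodule ≤ Θ) : finrank F (spreadElement Ψ hΨ h P) = h := by
  induction P using Projectivization.ind with
  | _ θ hθ₀ =>
  rw [Projectivization.submodule_mk, Submodule.span_singleton_le_iff_mem] at hP
  have hrange : spreadElement Ψ hΨ h (Projectivization.mk K θ hθ₀) =
      LinearMap.range (orbitSumMap F h hper θ) := by
    ext w
    rw [hΘ.mem_spreadElement hΨ hV hh hper hθ₀ hP, LinearMap.mem_range]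
    exact exists_congr fun c => (Subtype.ext_iff (a1 := orbitSumMap F h hper θ c)).symm
  rw [hrange, LinearMap.finrank_range_of_inj, hK]
  intro a c hac
  have := hΘ.orbitSum_inj hh hV (Θ.smul_mem a hP) (Θ.smul_mem c hP) (congrArg Subtype.val hac)
  exact smul_left_injective K hθ₀ this

theorem IsDirectorSpace.isSpread (hΨ : Function.Injective Ψ) (hK : finrank F K = h)
    (hΘ : IsDirectorSpace Ψ k h Θ)
    (hV : finrank K V = k * h) (hh : 0 < h) (hper : ∀ v, Ψ^[h] v = v) :
    IsSpread h (spreadOf Ψ hΨ h Θ) := by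
  refine ⟨?_, ?_⟩
  · rintro _ ⟨P, hP, rfl⟩
    exact hΘ.finrank_spreadElement hΨ hK hV hh hper hP
  · intro x
    induction x using Projectivization.ind with
    | _ w hw =>
    simp only [Projectivization.submodule_mk, Submodule.span_singleton_le_iff_mem]
    obtain ⟨θ, hθ, hw'⟩ := hΘ.exists_orbitSum_eq hV hh hper w
    have hθ₀ : θ ≠ 0 := by
      rintro rfl
      exact hw (Subtype.ext
        (hw'.symm.trans (Finset.sum_eq_zero fun i _ => iterate_zero' Ψ i)))
    refine ⟨spreadElement Ψ hΨ h (Projectivization.mk K θ hθ₀), ⟨⟨_, ?_, rfl⟩, ?_⟩, ?_⟩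
    · rwa [Projectivization.submodule_mk, Submodule.span_singleton_le_iff_mem]
    · rw [hΘ.mem_spreadElement hΨ hV hh hper hθ₀ hθ]
      exact ⟨1, by rw [one_smul, hw']⟩
    · rintro _ ⟨⟨P, hP, rfl⟩, hwP⟩
      induction P using Projectivization.ind with
      | _ θ' hθ'₀ =>
      rw [Projectivization.submodule_mk, Submodule.span_singleton_le_iff_mem] at hP
      rw [hΘ.mem_spreadElement hΨ hV hh hper hθ'₀ hP] at hwP
      obtain ⟨c, hc⟩ := hwP
      have h1 := hΘ.orbitSum_inj hh hV hθ (Θ.smul_mem c hP) (hw'.trans hc.symm)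
      congr 1
      exact ((Projectivization.mk_eq_mk_iff' K _ _ hθ₀ hθ'₀).2 ⟨c, h1.symm⟩).symm

variable [Module.Finite F (fixedSpace Ψ)]

/-- One inclusion is immediate; the extension has dimension `h`, and `h` vectors span the orbit
space. -/
theorem IsDirectorSpace.extension_spreadElement (hΨ : Function.Injective Ψ)
    (hK : finrank F K = h) (hΘ : IsDirectorSpace Ψ k h Θ)
    (hV : finrank K V = k * h) (hh : 0 < h) (hper : ∀ v, Ψ^[h] v = v) {P : ℙ K V}
    (hP : P.submodule ≤ Θ) :
    extension Ψ (spreadElement Ψ hΨ h P) = orbitSpan Ψ hΨ h P := by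
  refine Submodule.eq_of_le_of_finrank_le ?_ ?_
  · rw [extension, Submodule.span_le]
    rintro _ ⟨w, hw, rfl⟩
    exact hw
  · rw [finrank_extension, hΘ.finrank_spreadElement hΨ hK hV hh hper hP]
    exact finrank_orbitSpan_le hΨ h P

end Director

/-! ### Transport of spreads by automorphisms of the subgeometry -/

section Transport

variable {F K V : Type*} [Field F] [Fintype F] [Field K] [Finite K] [Algebra F K]
  [AddCommGroup V] [Module K V] {Ψ : V →ₛₗ[frob F K] V}

theorem IsDirectorSpace.of_exists_sum {k h : ℕ} {Θ : Submodule K V} (hΘ : finrank K Θ = k)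
    (hsum : ∀ v : V, ∃ θ : Fin h → Θ, ∑ i : Fin h, Ψ^[i] (θ i : V) = v) :
    IsDirectorSpace Ψ k h Θ := by
  refine ⟨hΘ, eq_top_iff.2 fun v _ => ?_⟩
  obtain ⟨θ, rfl⟩ := hsum v
  exact Submodule.sum_mem _ fun i _ =>
    le_iSup (fun i : Fin h => conjSubspace Ψ i Θ) i (mem_conjSubspace.2 ⟨θ i, (θ i).2, rfl⟩)

end Transport

section Transport

variable {F K V : Type*} [Field F] [Fintype F] [Field K] [Finite K] [Algebra F K]
  [AddCommGroup V] [Module F V] [Module K V] [IsScalarTower F K V] {Ψ : V →ₛₗ[frob F K] V}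

/-- A basis of the fixed space over `F` as a basis of the whole space over `K`. -/
noncomputable def coeBasis {ι : Type*} [Fintype ι] [Nonempty ι]
    (b : Basis ι F (fixedSpace Ψ)) (hcard : Fintype.card ι = finrank K V) : Basis ι K V :=
  basisOfLinearIndependentOfCardEqFinrank (linearIndependent_coe Ψ b.linearIndependent) hcard

variable {ι : Type*} [Fintype ι] [Nonempty ι]
  (b : Basis ι F (fixedSpace Ψ)) (hcard : Fintype.card ι = finrank K V)

@[simp]
theorem coeBasis_apply (i : ι) : coeBasis b hcard i = b i := by
  simp [coeBasis]

include b hcard in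
-- In a basis of fixed vectors, the iterates of `Ψ` act on coordinates by powers of Frobenius, whose
-- order is `finrank F K`.
theorem iterate_finrank_eq (v : V) : Ψ^[finrank F K] v = v := by
  rw [← (coeBasis b hcard).sum_repr v]
  simp only [iterate_sum, iterate_smul, coeBasis_apply, iterate_fixed, frob_iterate_finrank]

include b hcard in
-- Bases of the fixed space are bases of `V`, so `g` extends linearly; commutation with `Ψ` holds
-- because both bases are fixed by it.
theorem exists_equiv_extending (g : fixedSpace Ψ ≃ₗ[F] fixedSpace Ψ) :
    ∃ G : V ≃ₗ[K] V, (∀ w : fixedSpace Ψ, G w = g w) ∧ ∀ v, G (Ψ v) = Ψ (G v) := by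
  let B := coeBasis b hcard
  let B' := coeBasis (b.map g) hcard
  let G : V ≃ₗ[K] V := B.equiv B' (Equiv.refl ι)
  have hGB : ∀ i, G (b i : V) = g (b i) := by
    intro i
    have h1 : G (B i) = B' i := B.equiv_apply i B' (Equiv.refl ι)
    simpa [B, B'] using h1
  have hG : ∀ w : fixedSpace Ψ, G w = g w := by
    intro w
    rw [← b.sum_repr w, map_sum, Submodule.coe_sum, Submodule.coe_sum, map_sum]
    refine Finset.sum_congr rfl fun i _ => ?_
    rw [map_smul, Submodule.coe_smul, Submodule.coe_smul, ← algebraMap_smul K, map_smul, hGB,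
      algebraMap_smul]
  refine ⟨G, hG, fun v => ?_⟩
  rw [← B.sum_repr v]
  simp only [map_sum, LinearMap.map_smulₛₗ, map_smul]
  refine Finset.sum_congr rfl fun i _ => ?_
  congr 1
  rw [show B i = (b i : V) from coeBasis_apply b hcard i,
    show Ψ (b i : V) = b i from (b i).2, hG]
  exact (g (b i)).2.symm

include b hcard in
/-- The image of a spread `L(Φ)` under a linear automorphism of the subgeometry is again of the
form `L(Θ)`. -/
theorem exists_spreadOf_eq_image [Module.Finite K V] (hΨ : Function.Injective Ψ) {k h : ℕ}
    {Φ : Submodule K V} (hΦ : IsDirectorSpace Ψ k h Φ) (g : fixedSpace Ψ ≃ₗ[F] fixedSpace Ψ) :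
    ∃ Θ : Submodule K V, IsDirectorSpace Ψ k h Θ ∧
      (fun X => X.map (g : fixedSpace Ψ →ₗ[F] fixedSpace Ψ)) '' spreadOf Ψ hΨ h Φ =
        spreadOf Ψ hΨ h Θ := by
  obtain ⟨G, hG, hcomm⟩ := exists_equiv_extending b hcard g
  have hcomm' : ∀ (i : ℕ) (v : V), G (Ψ^[i] v) = Ψ^[i] (G v) := fun i v =>
    Function.Semiconj.iterate_right (f := G) hcomm i v
  have helem : ∀ (θ : V) (hθ : θ ≠ 0) (hθ' : G θ ≠ 0),
      (spreadElement Ψ hΨ h (Projectivization.mk K θ hθ)).map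
        (g : fixedSpace Ψ →ₗ[F] fixedSpace Ψ) =
      spreadElement Ψ hΨ h (Projectivization.mk K (G θ) hθ') := by
    intro θ hθ hθ'
    have hspan : orbitSpan Ψ hΨ h (Projectivization.mk K (G θ) hθ') =
        (orbitSpan Ψ hΨ h (Projectivization.mk K θ hθ)).map (G : V →ₗ[K] V) := by
      rw [orbitSpan_mk, orbitSpan_mk, Submodule.map_span, ← Set.range_comp]
      congr 2
      funext i
      exact (hcomm' i θ).symm
    ext w
    have hiff : w ∈ spreadElement Ψ hΨ h (Projectivization.mk K (G θ) hθ') ↔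
        (w : V) ∈ orbitSpan Ψ hΨ h (Projectivization.mk K (G θ) hθ') := Iff.rfl
    rw [hiff, hspan, Submodule.mem_map, Submodule.mem_map]
    constructor
    · rintro ⟨u, hu, rfl⟩
      exact ⟨u, hu, hG u⟩
    · rintro ⟨v, hv, hvw⟩
      refine ⟨g.symm w, ?_, g.apply_symm_apply w⟩
      have h1 : v = (g.symm w : V) := by
        apply G.injective
        rw [hG, g.apply_symm_apply]
        exact hvw
      rw [h1] at hv
      exact hv
  refine ⟨Φ.map (G : V →ₗ[K] V), ?_, ?_⟩
  · refine IsDirectorSpace.of_exists_sum ((LinearEquiv.finrank_map_eq G Φ).trans hΦ.1) fun v => ?_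
    obtain ⟨θ, hθ⟩ := hΦ.exists_sum (G.symm v)
    refine ⟨fun i => ⟨G (θ i), Submodule.mem_map_of_mem (θ i).2⟩, ?_⟩
    simp only [← hcomm', ← map_sum, hθ, G.apply_symm_apply]
  · ext X
    constructor
    · rintro ⟨_, ⟨P, hP, rfl⟩, rfl⟩
      induction P using Projectivization.ind with
      | _ θ hθ =>
      rw [Projectivization.submodule_mk, Submodule.span_singleton_le_iff_mem] at hP
      refine ⟨Projectivization.mk K (G θ) (G.map_ne_zero_iff.2 hθ), ?_, helem _ _ _⟩
      rw [Projectivization.submodule_mk, Submodule.span_singleton_le_iff_mem]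
      exact Submodule.mem_map_of_mem hP
    · rintro ⟨P, hP, rfl⟩
      induction P using Projectivization.ind with
      | _ v hv =>
      rw [Projectivization.submodule_mk, Submodule.span_singleton_le_iff_mem] at hP
      obtain ⟨θ, hθ, rfl⟩ := hP
      have hθ₀ : θ ≠ 0 := by
        rintro rfl
        exact hv (map_zero _)
      refine ⟨_, ⟨Projectivization.mk K θ hθ₀, ?_, rfl⟩, helem _ _ hv⟩
      rw [Projectivization.submodule_mk, Submodule.span_singleton_le_iff_mem]
      exact hθ

end Transport

/-! ### Bilinearity and injectivity of the Segre map -/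

section SegreMaps

variable {E W : Type*} [Field E] [AddCommGroup W] [Module E W] {k h : ℕ}

/-- The vectors `(x_i y_j)` for fixed `y`. -/
def segreLeft (b : Fin k × Fin h → W) (y : Fin h → E) : (Fin k → E) →ₗ[E] W where
  toFun x := segreVector b x y
  map_add' x x' := by
    simp only [segreVector, Pi.add_apply, add_mul, add_smul, Finset.sum_add_distrib]
  map_smul' c x := by
    simp only [segreVector, Pi.smul_apply, smul_eq_mul, mul_assoc, mul_smul, Finset.smul_sum,
      RingHom.id_apply]

/-- The vectors `(x_i y_j)` for fixed `x`. -/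
def segreRight (b : Fin k × Fin h → W) (x : Fin k → E) : (Fin h → E) →ₗ[E] W where
  toFun y := segreVector b x y
  map_add' y y' := by
    simp only [segreVector, Pi.add_apply, mul_add, add_smul, Finset.sum_add_distrib]
  map_smul' c y := by
    simp only [segreVector, Pi.smul_apply, smul_eq_mul, mul_left_comm _ c, mul_smul,
      Finset.smul_sum, RingHom.id_apply]

theorem segreVector_inj {b : Fin k × Fin h → W} (hb : LinearIndependent E b) {x x' : Fin k → E}
    {y y' : Fin h → E} (heq : segreVector b x y = segreVector b x' y') (i : Fin k) (j : Fin h) :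
    x i * y j = x' i * y' j := by
  have h1 : ∑ ij : Fin k × Fin h, (x ij.1 * y ij.2 - x' ij.1 * y' ij.2) • b ij = 0 := by
    simp only [sub_smul, Finset.sum_sub_distrib]
    exact sub_eq_zero.2 heq
  exact sub_eq_zero.1 (Fintype.linearIndependent_iff.1 hb _ h1 (i, j))

theorem segreVector_zero_left (b : Fin k × Fin h → W) (y : Fin h → E) :
    segreVector b 0 y = 0 := map_zero (segreLeft b y)

theorem segreVector_zero_right (b : Fin k × Fin h → W) (x : Fin k → E) :
    segreVector b x 0 = 0 := map_zero (segreRight b x)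

theorem segreVector_smul_left (b : Fin k × Fin h → W) (c : E) (x : Fin k → E) (y : Fin h → E) :
    segreVector b (c • x) y = c • segreVector b x y := map_smul (segreLeft b y) c x

theorem segreVector_smul_right (b : Fin k × Fin h → W) (c : E) (x : Fin k → E) (y : Fin h → E) :
    segreVector b x (c • y) = c • segreVector b x y := map_smul (segreRight b x) c y

theorem segreVector_ne_zero {b : Fin k × Fin h → W} (hb : LinearIndependent E b) {x : Fin k → E}
    {y : Fin h → E} (hx : x ≠ 0) (hy : y ≠ 0) : segreVector b x y ≠ 0 := by
  intro h0
  obtain ⟨i, hi⟩ := Function.ne_iff.1 hx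
  obtain ⟨j, hj⟩ := Function.ne_iff.1 hy
  have := segreVector_inj hb (h0.trans (segreVector_zero_right b x).symm) i j
  rw [Pi.zero_apply, mul_zero] at this
  exact mul_ne_zero hi hj this

theorem segreLeft_injective {b : Fin k × Fin h → W} (hb : LinearIndependent E b) {y : Fin h → E}
    (hy : y ≠ 0) : Function.Injective (segreLeft b y) :=
  (injective_iff_map_eq_zero _).2 fun _ h0 => by_contra fun hx => segreVector_ne_zero hb hx hy h0

theorem segreRight_injective {b : Fin k × Fin h → W} (hb : LinearIndependent E b) {x : Fin k → E}
    (hx : x ≠ 0) : Function.Injective (segreRight b x) :=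
  (injective_iff_map_eq_zero _).2 fun _ h0 => by_contra fun hy => segreVector_ne_zero hb hx hy h0

theorem segreVector_single (b : Fin k × Fin h → W) (i : Fin k) (j : Fin h) :
    segreVector b (Pi.single i 1) (Pi.single j (1 : E)) = b (i, j) := by
  rw [segreVector, Finset.sum_eq_single (i, j)]
  · simp
  · rintro ⟨i', j'⟩ _ hne
    by_cases hi : i' = i
    · have hj : j' ≠ j := fun hj => hne (by rw [hi, hj])
      simp [hj]
    · simp [hi]
  · simp

end SegreMaps

/-! ### Director spaces whose spread contains the regulus -/

section SegreDirector

variable {F K V : Type*} [Field F] [Fintype F] [Field K] [Algebra F K]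
  [AddCommGroup V] [Module F V] [Module K V] [IsScalarTower F K V] {Ψ : V →ₛₗ[frob F K] V}
  {k h : ℕ} (b : Basis (Fin k × Fin h) F (fixedSpace Ψ))

/-- The Segre vector over `K` in the coordinates given by a basis of the fixed space. -/
noncomputable abbrev coeSegre (x : Fin k → K) (y : Fin h → K) : V :=
  segreVector (fun ij => (b ij : V)) x y

theorem iterate_coeSegre (i : ℕ) (x : Fin k → K) (y : Fin h → K) :
    Ψ^[i] (coeSegre b x y) =
      coeSegre b (fun j => (frob F K)^[i] (x j)) (fun j => (frob F K)^[i] (y j)) := by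
  simp only [coeSegre, segreVector, iterate_sum, iterate_smul, iterate_fixed, frob_iterate_mul]

theorem coe_segreVector (x : Fin k → F) (y : Fin h → F) :
    ((segreVector b x y : fixedSpace Ψ) : V) =
      coeSegre b (fun j => algebraMap F K (x j)) (fun j => algebraMap F K (y j)) := by
  simp only [coeSegre, segreVector, Submodule.coe_sum, Submodule.coe_smul, ← map_mul,
    algebraMap_smul]

/-- The subspace of the vectors `(x_i y_j)` for fixed `y`. -/
noncomputable def segreSpace (y : Fin h → K) : Submodule K V :=
  LinearMap.range (segreLeft (fun ij => (b ij : V)) y)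

variable [Finite K]

theorem linearIndependent_coe_basis : LinearIndependent K (fun ij => (b ij : V)) :=
  linearIndependent_coe Ψ b.linearIndependent

theorem finrank_segreSpace {y : Fin h → K} (hy : y ≠ 0) : finrank K (segreSpace b y) = k := by
  rw [segreSpace, LinearMap.finrank_range_of_inj
    (segreLeft_injective (linearIndependent_coe_basis b) hy), finrank_fin_fun]

theorem exists_eq_sum_conj (hK : finrank F K = h) {y : Fin h → K} (hy : LinearIndependent F y)
    (z : Fin h → K) : ∃ d : Fin h → K, z = ∑ i, d i • fun j => (frob F K)^[i] (y j) := by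
  have hspan := (linearIndependent_conj hK hy).span_eq_top_of_card_eq_finrank' (by simp)
  have hz : z ∈ Submodule.span K
      (Set.range fun (i : Fin h) (j : Fin h) => (frob F K)^[i] (y j)) :=
    hspan ▸ Submodule.mem_top
  obtain ⟨d, hd⟩ := (Submodule.mem_span_range_iff_exists_fun K).1 hz
  exact ⟨d, hd.symm⟩

/-- The conjugates of `y` form a basis of K^h, so every e_i⊗e_j is a combination of the conjugates
of e_i⊗y. -/
theorem isDirectorSpace_segreSpace (hK : finrank F K = h) (hh : 0 < h)
    (hV : finrank K V = k * h) (hk : 0 < k) {y : Fin h → K} (hy : LinearIndependent F y) :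
    IsDirectorSpace Ψ k h (segreSpace b y) := by
  have hne : y ≠ 0 := fun h0 => hy.ne_zero ⟨0, hh⟩ (congrFun h0 _)
  refine ⟨finrank_segreSpace b hne, ?_⟩
  have : Nonempty (Fin k × Fin h) := ⟨(⟨0, hk⟩, ⟨0, hh⟩)⟩
  rw [eq_top_iff, ← (coeBasis b (by simp [hV])).span_eq, Submodule.span_le]
  rintro _ ⟨⟨i, j⟩, rfl⟩
  rw [coeBasis_apply, SetLike.mem_coe,
    ← segreVector_single (E := K) (fun ij => (b ij : V)) i j]
  obtain ⟨d, hd⟩ := exists_eq_sum_conj hK hy (Pi.single j (1 : K))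
  rw [hd]
  change segreRight (fun ij => (b ij : V)) (Pi.single i (1 : K)) _ ∈ _
  rw [map_sum]
  refine Submodule.sum_mem _ fun m _ => ?_
  rw [map_smul]
  refine Submodule.smul_mem _ _ (le_iSup (fun i : Fin h => conjSubspace Ψ i (segreSpace b y)) m
    (mem_conjSubspace.2 ⟨coeSegre b (Pi.single i 1) y, ⟨_, rfl⟩, ?_⟩))
  rw [iterate_coeSegre]
  suffices hpi : (fun l => (frob F K)^[m] ((Pi.single i 1 : Fin k → K) l)) = Pi.single i 1 by
    rw [hpi]
    rfl
  funext l
  by_cases hl : l = i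
  · subst hl
    simp
  · simp [hl]

/-- An `F`-relation on the coordinates of `y` also holds for all conjugates of `y`. It thus defines
a functional, on one row of coordinates, that vanishes on every conjugate of the director space and
so on `V`. -/
theorem linearIndependent_of_isDirectorSpace (hk : 0 < k) (hh : 0 < h) (hV : finrank K V = k * h)
    {y : Fin h → K} (hΘ : IsDirectorSpace Ψ k h (segreSpace b y)) : LinearIndependent F y := by
  have : Nonempty (Fin k × Fin h) := ⟨(⟨0, hk⟩, ⟨0, hh⟩)⟩
  let B := coeBasis b (by simp [hV])
  rw [Fintype.linearIndependent_iff]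
  intro z hz j₀
  let φ : V →ₗ[K] K := ∑ j, algebraMap F K (z j) • B.coord (⟨0, hk⟩, j)
  have hrepr : ∀ (x : Fin k → K) (u : Fin h → K) ij, B.coord ij (coeSegre b x u) =
      x ij.1 * u ij.2 := by
    intro x u ij
    have h1 : coeSegre b x u = ∑ ij, (x ij.1 * u ij.2) • B ij := by
      simp only [coeSegre, segreVector, B, coeBasis_apply]
    rw [h1, Basis.coord_apply, Basis.repr_sum_self]
  have hφ : ∀ v, φ v = 0 := by
    intro v
    obtain ⟨θ, rfl⟩ := hΘ.exists_sum v
    rw [map_sum]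
    refine Finset.sum_eq_zero fun i _ => ?_
    obtain ⟨x, hx⟩ := (θ i).2
    change coeSegre b x y = _ at hx
    rw [← hx, iterate_coeSegre]
    simp only [φ, LinearMap.sum_apply, LinearMap.smul_apply, hrepr, smul_eq_mul]
    have h2 : ∑ j, algebraMap F K (z j) * (frob F K)^[i] (y j) = 0 := by
      have h3 := congrArg ((frob F K)^[i]) hz
      simp only [frob_iterate_sum, Algebra.smul_def, frob_iterate_mul, frob_iterate_algebraMap]
        at h3
      rw [h3]
      exact iterate_map_zero (frob F K) i
    simp only [mul_left_comm _ ((frob F K)^[i] (x _)), ← Finset.mul_sum, h2, mul_zero]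
  have h4 := hφ (B (⟨0, hk⟩, j₀))
  simp only [φ, LinearMap.sum_apply, LinearMap.smul_apply, Basis.coord_apply, Basis.repr_self,
    smul_eq_mul] at h4
  rw [Finset.sum_eq_single j₀] at h4
  · simpa using h4
  · intro j _ hj
    rw [Finsupp.single_eq_of_ne (by simpa using hj), mul_zero]
  · simp

variable [Module.Finite K V]

/-- The regulus member over `x` is some X(P) with P in `Θ`, and P lies in its extension, contained
in x⊗K^h. -/
theorem exists_segreVector_mem (hΨ : Function.Injective Ψ) (hK : finrank F K = h) (hh : 0 < h)
    (hV : finrank K V = k * h) (hper : ∀ v, Ψ^[h] v = v) {Θ : Submodule K V}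
    (hΘ : IsDirectorSpace Ψ k h Θ) (hR : segreRegulus F b ⊆ spreadOf Ψ hΨ h Θ) {x : Fin k → F}
    (hx : x ≠ 0) :
    ∃ z : Fin h → K, z ≠ 0 ∧ coeSegre b (fun j => algebraMap F K (x j)) z ∈ Θ := by
  have : Module.Finite F (fixedSpace Ψ) := Module.Finite.of_basis b
  obtain ⟨P, hP, hX⟩ := hR (show LinearMap.range (segreRight b x) ∈ segreRegulus F b from
    ⟨x, hx, rfl⟩)
  have hext := hΘ.extension_spreadElement hΨ hK hV hh hper hP
  rw [← hX] at hext
  have hle : orbitSpan Ψ hΨ h P ≤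
      LinearMap.range (segreRight (fun ij => (b ij : V)) fun j => algebraMap F K (x j)) := by
    rw [← hext, extension, Submodule.span_le]
    rintro _ ⟨_, ⟨y, rfl⟩, rfl⟩
    exact ⟨fun j => algebraMap F K (y j), (coe_segreVector b x y).symm⟩
  have hPle := (conjPoint_le_orbitSpan hΨ hh hper 0 P).trans hle
  induction P using Projectivization.ind with
  | _ θ hθ₀ =>
  change (Projectivization.mk K θ hθ₀).submodule ≤ _ at hPle
  rw [Projectivization.submodule_mk, Submodule.span_singleton_le_iff_mem] at hPle hP
  obtain ⟨z, rfl⟩ := hPle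
  refine ⟨z, ?_, hP⟩
  rintro rfl
  exact hθ₀ (map_zero _)

/-- A director space whose spread contains the regulus of the Segre variety consists of the
vectors `(x_i y_j)` for a fixed `y`. -/
theorem exists_eq_segreSpace (hΨ : Function.Injective Ψ) (hK : finrank F K = h) (hh : 0 < h)
    (hk : 0 < k)
    (hV : finrank K V = k * h) (hper : ∀ v, Ψ^[h] v = v) {Θ : Submodule K V}
    (hΘ : IsDirectorSpace Ψ k h Θ) (hR : segreRegulus F b ⊆ spreadOf Ψ hΨ h Θ) :
    ∃ y : Fin h → K, Θ = segreSpace b y := by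
  have hb := linearIndependent_coe_basis b
  have hmem := fun {x : Fin k → F} (hx : x ≠ 0) =>
    exists_segreVector_mem b hΨ hK hh hV hper hΘ hR hx
  -- A frame argument: the unit vectors give a basis e_i⊗u_i of `Θ`, and the all-ones vector gives
  -- (1,…,1)⊗z in `Θ`, which forces a_i u_i = z for every i.
  obtain ⟨z, hz, hzΘ⟩ := hmem (x := fun _ => 1) (fun h0 => one_ne_zero (congrFun h0 ⟨0, hk⟩))
  have hsingle : ∀ i : Fin k, ∃ u : Fin h → K, u ≠ 0 ∧ coeSegre b (Pi.single i 1) u ∈ Θ := by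
    intro i
    obtain ⟨u, hu, huΘ⟩ := hmem (x := Pi.single i 1) (by simp)
    refine ⟨u, hu, ?_⟩
    convert huΘ using 2
    funext j
    by_cases hj : j = i
    · subst hj; simp
    · simp [hj]
  choose u hu huΘ using hsingle
  have hsum : ∀ a : Fin k → K, ∑ i, a i • coeSegre b (Pi.single i 1) (u i) =
      ∑ ij : Fin k × Fin h, (a ij.1 * u ij.1 ij.2) • (b ij : V) := by
    intro a
    simp only [coeSegre, segreVector, Finset.smul_sum]
    rw [Finset.sum_comm]
    refine Finset.sum_congr rfl fun ij _ => ?_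
    rw [Finset.sum_eq_single ij.1]
    · rw [Pi.single_eq_same, one_mul, mul_smul]
    · intro i _ hi
      rw [Pi.single_eq_of_ne hi.symm, zero_mul, zero_smul, smul_zero]
    · simp
  have hind : LinearIndependent K fun i => coeSegre b (Pi.single i 1) (u i) := by
    rw [Fintype.linearIndependent_iff]
    intro a ha i
    rw [hsum] at ha
    obtain ⟨j, hj⟩ := Function.ne_iff.1 (hu i)
    exact (mul_eq_zero.1 (Fintype.linearIndependent_iff.1 hb _ ha (i, j))).resolve_right hj
  have hspan : Submodule.span K (Set.range fun i => coeSegre b (Pi.single i 1) (u i)) = Θ := by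
    refine Submodule.eq_of_le_of_finrank_le ?_ ?_
    · rw [Submodule.span_le]
      rintro _ ⟨i, rfl⟩
      exact huΘ i
    · rw [finrank_span_eq_card hind, hΘ.1, Fintype.card_fin]
  have hz' := hzΘ
  rw [← hspan, Submodule.mem_span_range_iff_exists_fun] at hz'
  obtain ⟨a, ha⟩ := hz'
  have hcoord : ∀ i j, a i * u i j = z j := by
    intro i j
    rw [hsum] at ha
    have h1 : ∑ ij : Fin k × Fin h, (a ij.1 * u ij.1 ij.2 - z ij.2) • (b ij : V) = 0 := by
      simp only [sub_smul, Finset.sum_sub_distrib, ha]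
      simp [coeSegre, segreVector]
    exact sub_eq_zero.1 (Fintype.linearIndependent_iff.1 hb _ h1 (i, j))
  refine ⟨z, (Submodule.eq_of_le_of_finrank_eq ?_ ?_).symm⟩
  · rintro _ ⟨x, rfl⟩
    rw [← hspan, Submodule.mem_span_range_iff_exists_fun]
    refine ⟨fun i => x i * a i, ?_⟩
    rw [hsum]
    simp only [mul_assoc, hcoord]
    rfl
  · rw [finrank_segreSpace b hz, hΘ.1]

/-- The spread element of a point with rational left factor is a member of the regulus. -/
theorem spreadElement_coeSegre (hΨ : Function.Injective Ψ) (hK : finrank F K = h) (hh : 0 < h)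
    (hV : finrank K V = k * h) (hper : ∀ v, Ψ^[h] v = v) {y : Fin h → K}
    (hΘ : IsDirectorSpace Ψ k h (segreSpace b y)) {x : Fin k → F} (hx : x ≠ 0)
    (hθ₀ : coeSegre b (fun j => algebraMap F K (x j)) y ≠ 0) :
    spreadElement Ψ hΨ h (Projectivization.mk K _ hθ₀) = LinearMap.range (segreRight b x) := by
  have : Module.Finite F (fixedSpace Ψ) := Module.Finite.of_basis b
  have hb := linearIndependent_coe_basis b
  obtain ⟨i₀, hi₀⟩ := Function.ne_iff.1 hx
  have hi₀' : algebraMap F K (x i₀) ≠ 0 := (map_ne_zero _).2 hi₀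
  have hP : (Projectivization.mk K _ hθ₀).submodule ≤ segreSpace b y := by
    rw [Projectivization.submodule_mk, Submodule.span_singleton_le_iff_mem]
    exact ⟨fun j => algebraMap F K (x j), rfl⟩
  refine Submodule.eq_of_le_of_finrank_eq ?_ ?_
  · intro w hw
    have hw' : (w : V) ∈ orbitSpan Ψ hΨ h (Projectivization.mk K _ hθ₀) := hw
    rw [orbitSpan_mk, Submodule.mem_span_range_iff_exists_fun] at hw'
    obtain ⟨c, hc⟩ := hw'
    have hconj : ∀ i : ℕ, Ψ^[i] (segreVector (fun ij => (b ij : V))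
        (fun j => algebraMap F K (x j)) y) =
        segreRight (fun ij => (b ij : V)) (fun j => algebraMap F K (x j))
          (fun j => (frob F K)^[i] (y j)) := by
      intro i
      rw [iterate_coeSegre]
      simp only [frob_iterate_algebraMap]
      rfl
    simp only [hconj, ← map_smul, ← map_sum] at hc
    set z : Fin h → K := ∑ i : Fin h, c i • fun j => (frob F K)^[i] (y j) with hz
    change coeSegre b (fun j => algebraMap F K (x j)) z = (w : V) at hc
    -- A combination of the conjugates is x⊗z. When it is fixed by `Ψ`, dividing by the nonzero
    -- rational coordinate `x i₀` shows that `z` is rational.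
    have hfix : ∀ j, frob F K (z j) = z j := by
      intro j
      have h1 : Ψ (coeSegre b (fun j => algebraMap F K (x j)) z) =
          coeSegre b (fun j => algebraMap F K (x j)) z := by
        rw [hc]; exact w.2
      have h2 := iterate_coeSegre b 1 (fun j => algebraMap F K (x j)) z
      simp only [frob_iterate_algebraMap] at h2
      have h3 := segreVector_inj hb (h2.symm.trans h1) i₀ j
      exact mul_left_cancel₀ hi₀' h3
    choose y' hy' using fun j => exists_algebraMap_eq_of_frob_eq (hfix j)
    refine ⟨y', Subtype.ext ?_⟩
    rw [← hc]
    refine (coe_segreVector b x y').trans ?_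
    simp only [hy']
  · rw [hΘ.finrank_spreadElement hΨ hK hV hh hper hP, LinearMap.finrank_range_of_inj
      (segreRight_injective b.linearIndependent hx), finrank_fin_fun]

theorem segreRegulus_subset (hΨ : Function.Injective Ψ) (hK : finrank F K = h) (hh : 0 < h)
    (hV : finrank K V = k * h) (hper : ∀ v, Ψ^[h] v = v) {y : Fin h → K}
    (hΘ : IsDirectorSpace Ψ k h (segreSpace b y)) (hy : y ≠ 0) :
    segreRegulus F b ⊆ spreadOf Ψ hΨ h (segreSpace b y) := by
  rintro X ⟨x, hx, hX⟩
  have hX' : X = LinearMap.range (segreRight b x) := SetLike.ext' hX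
  obtain ⟨i₀, hi₀⟩ := Function.ne_iff.1 hx
  have hx' : (fun j => algebraMap F K (x j)) ≠ 0 := fun h0 =>
    (map_ne_zero (algebraMap F K)).2 hi₀ (congrFun h0 i₀)
  have hθ₀ := segreVector_ne_zero (linearIndependent_coe_basis b) hx' hy
  refine ⟨Projectivization.mk K _ hθ₀, ?_,
    hX'.trans (spreadElement_coeSegre b hΨ hK hh hV hper hΘ hx hθ₀).symm⟩
  rw [Projectivization.submodule_mk, Submodule.span_singleton_le_iff_mem]
  exact ⟨fun j => algebraMap F K (x j), rfl⟩

end SegreDirector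

/-! ### Comparing spreads through the regulus -/

section Uniqueness

variable {F K V : Type*} [Field F] [Fintype F] [Field K] [Algebra F K]
  [AddCommGroup V] [Module F V] [Module K V] [IsScalarTower F K V] {Ψ : V →ₛₗ[frob F K] V}
  {k h : ℕ} (b : Basis (Fin k × Fin h) F (fixedSpace Ψ))

/-- The map u ↦ σ^m(u) - e u is `F`-linear, and `he` makes it injective. -/
theorem linearIndependent_frob_sub {y : Fin h → K} (hy : LinearIndependent F y) {m : ℕ} {e : K}
    (he : ∀ u, (frob F K)^[m] u = e * u → u = 0) :
    LinearIndependent F fun j => (frob F K)^[m] (y j) - e * y j := by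
  rw [Fintype.linearIndependent_iff] at hy ⊢
  intro z hz
  refine hy z (he _ (sub_eq_zero.1 ?_))
  rw [← hz, frob_iterate_sum, Finset.mul_sum, ← Finset.sum_sub_distrib]
  refine Finset.sum_congr rfl fun j _ => ?_
  rw [Algebra.smul_def, Algebra.smul_def, frob_iterate_mul, frob_iterate_algebraMap]
  ring

/-- A point of `S(K^k, y)` is represented by a vector with some left coordinate equal to one. -/
theorem exists_mk_eq {y : Fin h → K} {P : ℙ K V} (hP : P.submodule ≤ segreSpace b y) :
    ∃ (x : Fin k → K) (i : Fin k) (hne : coeSegre b x y ≠ 0), x i = 1 ∧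
      P = Projectivization.mk K (coeSegre b x y) hne := by
  induction P using Projectivization.ind with
  | _ v hv =>
  rw [Projectivization.submodule_mk, Submodule.span_singleton_le_iff_mem] at hP
  obtain ⟨x, hx⟩ := hP
  change coeSegre b x y = v at hx
  have hx₀ : x ≠ 0 := by
    rintro rfl
    exact hv (hx.symm.trans (segreVector_zero_left _ _))
  obtain ⟨i, hi⟩ := Function.ne_iff.1 hx₀
  have hsmul : coeSegre b ((x i)⁻¹ • x) y = (x i)⁻¹ • v := by
    rw [← hx]
    exact segreVector_smul_left _ _ _ _
  refine ⟨(x i)⁻¹ • x, i, ?_, inv_mul_cancel₀ hi, ?_⟩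
  · rw [hsmul]
    exact smul_ne_zero (inv_ne_zero hi) hv
  · symm
    rw [Projectivization.mk_eq_mk_iff']
    exact ⟨(x i)⁻¹, hsmul.symm⟩

theorem mk_coeSegre_le {x : Fin k → K} {y : Fin h → K} (hne : coeSegre b x y ≠ 0) :
    (Projectivization.mk K _ hne).submodule ≤ segreSpace b y := by
  rw [Projectivization.submodule_mk, Submodule.span_singleton_le_iff_mem]
  exact ⟨x, rfl⟩

variable (hΨ : Function.Injective Ψ)

theorem spreadElement_conjPoint (hh : 0 < h) (hper : ∀ v, Ψ^[h] v = v) (n : ℕ) (P : ℙ K V) :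
    spreadElement Ψ hΨ h (conjPoint Ψ hΨ n P) = spreadElement Ψ hΨ h P := by
  rw [spreadElement, orbitSpan_conjPoint hΨ hh hper]
  rfl

variable [Finite K]

/-- Each row is an identity between combinations of the conjugates of `y`, which are independent
over `K`. -/
theorem coeff_eq_of_segreVector_eq (hK : finrank F K = h) {y : Fin h → K}
    (hy : LinearIndependent F y) {x x₀ : Fin k → K} {c d : Fin h → K}
    (heq : coeSegre b x (∑ i, d i • fun j => (frob F K)^[i] (y j)) =
      ∑ i : Fin h, c i • Ψ^[i] (coeSegre b x₀ y)) (r : Fin k) (i : Fin h) :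
    x r * d i = c i * (frob F K)^[i] (x₀ r) := by
  have hcoord : ∀ j, ∑ i : Fin h, (x r * d i) * (frob F K)^[i] (y j) =
      ∑ i : Fin h, (c i * (frob F K)^[i] (x₀ r)) * (frob F K)^[i] (y j) := by
    intro j
    have hrhs : ∑ i : Fin h, c i • Ψ^[i] (coeSegre b x₀ y) =
        ∑ ij : Fin k × Fin h, (∑ i : Fin h,
          (c i * (frob F K)^[i] (x₀ ij.1)) * (frob F K)^[i] (y ij.2)) • (b ij : V) := by
      simp only [iterate_coeSegre]
      simp only [coeSegre, segreVector, Finset.smul_sum, Finset.sum_smul, mul_smul]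
      exact Finset.sum_comm
    rw [hrhs, coeSegre, segreVector, ← sub_eq_zero, ← Finset.sum_sub_distrib] at heq
    simp only [← sub_smul] at heq
    have h1 := sub_eq_zero.1
      (Fintype.linearIndependent_iff.1 (linearIndependent_coe_basis b) _ heq (r, j))
    rw [← h1, Finset.sum_apply, Finset.mul_sum]
    exact Finset.sum_congr rfl fun i _ => mul_assoc _ _ _
  have hzero : ∑ i : Fin h, (x r * d i - c i * (frob F K)^[i] (x₀ r)) •
      (fun j => (frob F K)^[i] (y j)) = 0 := by
    funext j
    simp only [Finset.sum_apply, Pi.smul_apply, smul_eq_mul, sub_mul, Finset.sum_sub_distrib,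
      Pi.zero_apply]
    exact sub_eq_zero.2 (hcoord j)
  exact sub_eq_zero.1 (Fintype.linearIndependent_iff.1 (linearIndependent_conj hK hy) _ hzero i)

/-- If the `m`-th power of Frobenius fixes an element other than `0` and `1`, then `u ↦ u^σ^m / u`
is not surjective. -/
theorem exists_forall_frob_iterate_ne {m : ℕ} {t : K} (ht : (frob F K)^[m] t = t) (ht₀ : t ≠ 0)
    (ht₁ : t ≠ 1) : ∃ e : K, e ≠ 0 ∧ ∀ u, (frob F K)^[m] u = e * u → u = 0 := by
  -- `f` takes the value 1 at both `t` and 1, so it is not onto the finite field. Since `f 0 = 0` by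
  -- convention, the missed value is nonzero.
  let f : K → K := fun u => (frob F K)^[m] u / u
  have hf : ¬ Function.Surjective f := by
    rw [← Finite.injective_iff_surjective]
    intro hinj
    refine ht₁ (hinj (?_ : f t = f 1))
    simp only [f, ht, div_self ht₀, iterate_map_one, div_one]
  rw [Function.Surjective] at hf
  push Not at hf
  obtain ⟨e, he⟩ := hf
  refine ⟨e, fun h0 => he 0 (by simp [f, h0]), fun u hu => ?_⟩
  by_contra hu₀
  exact he u (by simp only [f, hu, mul_div_cancel_right₀ _ hu₀])

/-- The director space of `y'` is a conjugate of that of `y`, and conjugate points give the same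
spread element. -/
theorem spreadOf_segreSpace_conj (hh : 0 < h) (hper : ∀ v, Ψ^[h] v = v) {y y' : Fin h → K} {n : ℕ}
    {c : K} (hc : c ≠ 0) (hy' : y' = c • fun j => (frob F K)^[n] (y j)) :
    spreadOf Ψ hΨ h (segreSpace b y') = spreadOf Ψ hΨ h (segreSpace b y) := by
  have hconj : ∀ x : Fin k → K, coeSegre b (c⁻¹ • fun j => (frob F K)^[n] (x j)) y' =
      Ψ^[n] (coeSegre b x y) := by
    intro x
    rw [hy', iterate_coeSegre]
    refine (segreVector_smul_left _ _ _ _).trans ?_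
    rw [segreVector_smul_right, smul_smul, inv_mul_cancel₀ hc, one_smul]
  ext X
  constructor
  · rintro ⟨P, hP, rfl⟩
    obtain ⟨x', _, hne, _, rfl⟩ := exists_mk_eq b hP
    choose x hx using fun j => frob_iterate_surjective (F := F) n (c * x' j)
    have hx' : x' = c⁻¹ • fun j => (frob F K)^[n] (x j) := by
      funext j
      rw [Pi.smul_apply, hx, smul_eq_mul, inv_mul_cancel_left₀ hc]
    subst hx'
    have hne' : coeSegre b x y ≠ 0 := by
      intro h0
      rw [hconj, h0] at hne
      exact hne (iterate_zero' Ψ n)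
    refine ⟨Projectivization.mk K _ hne', mk_coeSegre_le b hne', ?_⟩
    rw [← spreadElement_conjPoint hΨ hh hper n (Projectivization.mk K _ hne'), conjPoint_mk]
    congr 2
    exact hconj x
  · rintro ⟨P, hP, rfl⟩
    obtain ⟨x, _, hne, _, rfl⟩ := exists_mk_eq b hP
    have hne' := iterate_ne_zero (i := n) Ψ hΨ hne
    rw [← hconj] at hne'
    refine ⟨Projectivization.mk K _ hne', mk_coeSegre_le b hne', ?_⟩
    rw [← spreadElement_conjPoint hΨ hh hper n, conjPoint_mk]
    congr 2
    exact (hconj x).symm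

/-- If a point other than the conjugates of `P = ⟨(x_i y_j)⟩` lies both on the span of these
conjugates and on the Segre variety, then the left factor of `P` is fixed, up to a scalar, by a
proper power of Frobenius. -/
theorem exists_frob_iterate_eq_smul (hK : finrank F K = h) {y : Fin h → K}
    (hy : LinearIndependent F y) {x : Fin k → K} (hx : x ≠ 0) (hne : coeSegre b x y ≠ 0) {Q : ℙ K V}
    (hQ : Q.submodule ≤ orbitSpan Ψ hΨ h (Projectivization.mk K _ hne))
    (hQS : Q ∈ segreVariety K fun ij => (b ij : V))
    (hQP : Q ∉ Set.range fun i : Fin h => conjPoint Ψ hΨ i (Projectivization.mk K _ hne)) :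
    ∃ (m : ℕ) (a : K), 0 < m ∧ m < h ∧ ∀ r, (frob F K)^[m] (x r) = a * x r := by
  obtain ⟨x₁, y₁, hne₁, rfl⟩ := hQS
  rw [Projectivization.submodule_mk, Submodule.span_singleton_le_iff_mem, orbitSpan_mk,
    Submodule.mem_span_range_iff_exists_fun] at hQ
  obtain ⟨c, hc⟩ := hQ
  obtain ⟨d, rfl⟩ := exists_eq_sum_conj hK hy y₁
  have hcoeff := coeff_eq_of_segreVector_eq b hK hy hc.symm
  obtain ⟨r₀, hr₀⟩ := Function.ne_iff.1 hx
  have hr₀' : ∀ i : ℕ, (frob F K)^[i] (x r₀) ≠ 0 := fun i h0 => hr₀ (frob_iterate_eq_zero.1 h0)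
  -- With a single nonzero coefficient, the point would be a conjugate of P.
  have htwo : ∃ i j : Fin h, i < j ∧ c i ≠ 0 ∧ c j ≠ 0 := by
    have hex : ∃ i, c i ≠ 0 := by
      by_contra! h0
      exact hne₁ (by rw [← hc]; simp [h0])
    obtain ⟨i, hi⟩ := hex
    by_contra! hno
    apply hQP
    refine ⟨i, ?_⟩
    have honly : ∀ j, j ≠ i → c j = 0 := by
      intro j hj
      by_contra hcj
      rcases lt_or_gt_of_ne hj with hlt | hlt
      · exact hi (hno j i hlt hcj)
      · exact hcj (hno i j hlt hi)
    simp only [conjPoint_mk]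
    symm
    rw [Projectivization.mk_eq_mk_iff']
    refine ⟨c i, ?_⟩
    rw [← hc, Finset.sum_eq_single i]
    · intro j _ hj
      rw [honly j hj, zero_smul]
    · simp
  obtain ⟨i, j, hij, hi, hj⟩ := htwo
  have hdi : d i ≠ 0 := by
    intro h0
    have := hcoeff r₀ i
    rw [h0, mul_zero] at this
    exact mul_ne_zero hi (hr₀' i) this.symm
  -- Eliminating the left factor x₁ from `hcoeff` at i and j makes σ^j(x) the multiple of σ^i(x) by
  -- this quotient; undoing σ^i gives m = j - i.
  obtain ⟨a, ha⟩ := frob_iterate_surjective (F := F) (i : ℕ) (c i * d j / (c j * d i))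
  refine ⟨j - i, a, Nat.sub_pos_of_lt hij, by omega, fun r => ?_⟩
  apply (frob F K).injective.iterate i
  rw [← Function.iterate_add_apply, Nat.add_sub_cancel' hij.le, frob_iterate_mul, ha,
    div_mul_eq_mul_div, eq_div_iff (mul_ne_zero hj hdi)]
  linear_combination (-d i) * hcoeff r j + d j * hcoeff r i

variable [Module.Finite K V]

theorem IsDirectorSpace.isDesarguesian (hK : finrank F K = h) {Θ : Submodule K V}
    (hΘ : IsDirectorSpace Ψ k h Θ)
    (hV : finrank K V = k * h) (hh : 0 < h) (hper : ∀ v, Ψ^[h] v = v) :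
    IsDesarguesian Ψ hΨ k h (spreadOf Ψ hΨ h Θ) := by
  refine ⟨hΘ.isSpread hΨ hK hV hh hper, Θ, hΘ, LinearEquiv.refl F _, ?_⟩
  simp

/-- If the left factor of a point `P` of a director space is fixed by a proper power of Frobenius
but not rational, then some other Desarguesian spread contains the regulus and `X(P)`. -/
theorem exists_ne_spreadOf (hK : finrank F K = h) (hh : 0 < h) (hk : 0 < k)
    (hV : finrank K V = k * h) (hper : ∀ v, Ψ^[h] v = v) {y : Fin h → K}
    (hΘ : IsDirectorSpace Ψ k h (segreSpace b y)) {x : Fin k → K} (hne : coeSegre b x y ≠ 0)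
    {m : ℕ} (hm : 0 < m) (hmh : m < h) (hxm : ∀ r, (frob F K)^[m] (x r) = x r) {i₀ i₁ : Fin k}
    (hi₀ : x i₀ = 1) (hi₁ : frob F K (x i₁) ≠ x i₁) :
    ∃ Θ' : Submodule K V, IsDirectorSpace Ψ k h Θ' ∧
      spreadElement Ψ hΨ h (Projectivization.mk K _ hne) ∈ spreadOf Ψ hΨ h Θ' ∧
      segreRegulus F b ⊆ spreadOf Ψ hΨ h Θ' ∧
      spreadOf Ψ hΨ h Θ' ≠ spreadOf Ψ hΨ h (segreSpace b y) := by
  have : Module.Finite F (fixedSpace Ψ) := Module.Finite.of_basis b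
  have hb := linearIndependent_coe_basis b
  have hy := linearIndependent_of_isDirectorSpace b hk hh hV hΘ
  obtain ⟨e, he₀, he⟩ := exists_forall_frob_iterate_ne (hxm i₁)
    (fun h0 => hi₁ (by rw [h0, map_zero])) (fun h1 => hi₁ (by rw [h1, map_one]))
  have hy' := linearIndependent_frob_sub hy he
  set y' : Fin h → K := fun j => (frob F K)^[m] (y j) - e * y j with hy'_def
  have hy'₀ : y' ≠ 0 := fun h0 => hy'.ne_zero ⟨0, hh⟩ (congrFun h0 _)
  have hΘ' := isDirectorSpace_segreSpace b hK hh hV hk hy'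
  have hx₀ : x ≠ 0 := fun h0 => one_ne_zero (hi₀.symm.trans (congrFun h0 i₀))
  refine ⟨segreSpace b y', hΘ', ?_, segreRegulus_subset b hΨ hK hh hV hper hΘ' hy'₀, ?_⟩
  · have hne' := segreVector_ne_zero hb hx₀ hy'₀
    have hQ : (Projectivization.mk K _ hne').submodule ≤
        orbitSpan Ψ hΨ h (Projectivization.mk K _ hne) := by
      rw [Projectivization.submodule_mk, Submodule.span_singleton_le_iff_mem]
      have h1 : segreVector (fun ij => (b ij : V)) x y' =
          Ψ^[m] (coeSegre b x y) - e • coeSegre b x y := by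
        rw [iterate_coeSegre]
        simp only [hxm]
        exact (map_sub (segreRight (fun ij => (b ij : V)) x) (fun j => (frob F K)^[m] (y j))
          (e • y)).trans (congrArg _ (segreVector_smul_right _ _ _ _))
      have hmem : ∀ n, Ψ^[n] (coeSegre b x y) ∈
          orbitSpan Ψ hΨ h (Projectivization.mk K _ hne) := by
        intro n
        apply conjPoint_le_orbitSpan hΨ hh hper n
        rw [conjPoint_mk, Projectivization.submodule_mk]
        exact Submodule.mem_span_singleton_self _
      rw [h1]
      exact Submodule.sub_mem _ (hmem m) (Submodule.smul_mem _ _ (hmem 0))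
    refine ⟨_, mk_coeSegre_le b hne', (Submodule.eq_of_le_of_finrank_eq ?_ ?_).symm⟩
    · intro w hw
      exact orbitSpan_le hΨ hh hper hQ hw
    · rw [hΘ.finrank_spreadElement hΨ hK hV hh hper (mk_coeSegre_le b hne),
        hΘ'.finrank_spreadElement hΨ hK hV hh hper (mk_coeSegre_le b hne')]
  · intro heq
    obtain ⟨s, hs⟩ := exists_frob_iterate_ne (F := F) (K := K) hm (hK ▸ hmh)
    have hi : i₀ ≠ i₁ := by
      rintro rfl
      exact hi₁ (by rw [hi₀, map_one])
    -- If u⊗y' were in the span of the orbit of some x'⊗y, the components along y and σ^m(y) would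
    -- make `u` proportional to both x' and σ^m(x'). The entries 1 and `s` would then force σ^m(s) =
    -- s.
    set u : Fin k → K := Function.update (Pi.single i₀ 1) i₁ s with hu
    have hu₀ : u i₀ = 1 := by rw [hu, Function.update_of_ne hi, Pi.single_eq_same]
    have hu₁ : u i₁ = s := by rw [hu, Function.update_self]
    have hune : u ≠ 0 := fun h0 => one_ne_zero (hu₀.symm.trans (congrFun h0 i₀))
    have hne' : coeSegre b u y' ≠ 0 := segreVector_ne_zero hb hune hy'₀
    have hmem : spreadElement Ψ hΨ h (Projectivization.mk K _ hne') ∈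
        spreadOf Ψ hΨ h (segreSpace b y) := by
      rw [← heq]
      exact ⟨_, mk_coeSegre_le b hne', rfl⟩
    obtain ⟨P, hP, hX⟩ := hmem
    have hspan : orbitSpan Ψ hΨ h (Projectivization.mk K _ hne') = orbitSpan Ψ hΨ h P := by
      rw [← hΘ.extension_spreadElement hΨ hK hV hh hper hP, ← hX,
        hΘ'.extension_spreadElement hΨ hK hV hh hper (mk_coeSegre_le b hne')]
    obtain ⟨x', _, hnex', _, rfl⟩ := exists_mk_eq b hP
    have hin : coeSegre b u y' ∈ orbitSpan Ψ hΨ h (Projectivization.mk K _ hnex') := by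
      rw [← hspan]
      apply conjPoint_le_orbitSpan hΨ hh hper 0
      rw [conjPoint_mk, Projectivization.submodule_mk]
      exact Submodule.mem_span_singleton_self _
    rw [orbitSpan_mk, Submodule.mem_span_range_iff_exists_fun] at hin
    obtain ⟨c, hc⟩ := hin
    set d : Fin h → K := Pi.single ⟨m, hmh⟩ 1 - Pi.single ⟨0, hh⟩ e with hd
    have hm0 : (⟨m, hmh⟩ : Fin h) ≠ ⟨0, hh⟩ := fun h0 => hm.ne' (congrArg Fin.val h0)
    have hdsum : y' = ∑ i, d i • fun j => (frob F K)^[i] (y j) := by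
      funext j
      simp [hd, hy'_def, sub_mul, Finset.sum_sub_distrib, Pi.single_apply, ite_mul]
    rw [hdsum] at hc
    have hcoeff := coeff_eq_of_segreVector_eq b hK hy hc.symm
    have hdm : d ⟨m, hmh⟩ = 1 := by
      rw [hd, Pi.sub_apply, Pi.single_eq_same, Pi.single_eq_of_ne hm0, sub_zero]
    have hd0 : d ⟨0, hh⟩ = -e := by
      rw [hd, Pi.sub_apply, Pi.single_eq_same, Pi.single_eq_of_ne hm0.symm, zero_sub]
    have e1 := hcoeff i₀ ⟨m, hmh⟩
    have e2 := hcoeff i₁ ⟨m, hmh⟩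
    have e3 := hcoeff i₀ ⟨0, hh⟩
    have e4 := hcoeff i₁ ⟨0, hh⟩
    rw [hdm, hu₀, mul_one] at e1
    rw [hdm, hu₁, mul_one] at e2
    rw [hd0, hu₀, one_mul] at e3
    rw [hd0, hu₁] at e4
    simp only [Function.iterate_zero, id] at e3 e4
    have hc0 : c ⟨0, hh⟩ ≠ 0 := by
      intro h0
      rw [h0, zero_mul] at e3
      exact he₀ (neg_eq_zero.1 e3)
    have e5 : x' i₁ = s * x' i₀ := by
      apply mul_left_cancel₀ hc0
      rw [← e4, e3]
      ring
    rw [e5, frob_iterate_mul] at e2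
    simp only at e1 e2
    apply hs
    linear_combination ((frob F K)^[m] s) * e1 - e2

end Uniqueness

end DesarguesianSpread

/-! ### The uniqueness criterion -/

theorem corollary3p7 {F K V : Type*} [Field F] [Fintype F] [Field K] [Finite K] [Algebra F K]
    [AddCommGroup V] [Module F V] [Module K V] [IsScalarTower F K V] (k h : ℕ)
    -- `F = 𝔽_q`, `K = 𝔽_{q^h}`, `PG(V) = PG(kh-1, q^h)`
    (hK : Module.finrank F K = h) (hV : Module.finrank K V = k * h)
    -- the semilinear collineation and homogeneous coordinates on `Π = Fix(Ψ) ≃ PG(kh-1, q)`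
    (Ψ : V →ₛₗ[DesarguesianSpread.frob F K] V) (hΨ : Function.Injective Ψ)
    (b : Module.Basis (Fin k × Fin h) F (DesarguesianSpread.fixedSpace Ψ))
    -- `Ξ` is an `(h-1)`-dimensional subspace of `Π` disjoint from `S_{k-1,h-1}(q)`
    (Ξ : Submodule F (DesarguesianSpread.fixedSpace Ψ)) (hΞ : Module.finrank F Ξ = h)
    (hdisj : ∀ Q ∈ DesarguesianSpread.segreVariety F b, ¬ Q.submodule ≤ Ξ)
    -- `L(Θ)` contains `Ξ` and `R_{h,q}`
    (Θ : Submodule K V) (hΘ : DesarguesianSpread.IsDirectorSpace Ψ k h Θ)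
    (hΞΘ : Ξ ∈ DesarguesianSpread.spreadOf Ψ hΨ h Θ)
    (hRΘ : DesarguesianSpread.segreRegulus F b ⊆ DesarguesianSpread.spreadOf Ψ hΨ h Θ) :
    ∃ P : Projectivization K V,
      P.submodule = Θ ⊓ DesarguesianSpread.extension Ψ Ξ ∧
      ({D : Set (Submodule F (DesarguesianSpread.fixedSpace Ψ)) |
          DesarguesianSpread.IsDesarguesian Ψ hΨ k h D ∧ Ξ ∈ D ∧
            DesarguesianSpread.segreRegulus F b ⊆ D}
          = {DesarguesianSpread.spreadOf Ψ hΨ h Θ} ↔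
        {Q : Projectivization K V | Q.submodule ≤ DesarguesianSpread.extension Ψ Ξ} ∩
            DesarguesianSpread.segreVariety K
              (fun ij => (b ij : V))
          = Set.range fun i : Fin h => DesarguesianSpread.conjPoint Ψ hΨ i P) := by
  have hh : 0 < h := by
    have : FiniteDimensional F K := Module.Finite.of_finite
    exact hK ▸ Module.finrank_pos
  have hk : 0 < k := by
    have := Module.Finite.of_basis b
    have hle := Submodule.finrank_le Ξ
    rw [hΞ, finrank_eq_card_basis b, Fintype.card_prod, Fintype.card_fin, Fintype.card_fin] at hle
    exact pos_of_mul_pos_left (hh.trans_le hle) hh.le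
  have : Nonempty (Fin k × Fin h) := ⟨(⟨0, hk⟩, ⟨0, hh⟩)⟩
  have : Module.Finite K V := Module.finite_of_finrank_pos (hV ▸ Nat.mul_pos hk hh)
  have : Module.Finite F (DesarguesianSpread.fixedSpace Ψ) := Module.Finite.of_basis b
  have hcard : Fintype.card (Fin k × Fin h) = finrank K V := by simp [hV]
  have hper : ∀ v, Ψ^[h] v = v := hK ▸ DesarguesianSpread.iterate_finrank_eq b hcard
  have hb := DesarguesianSpread.linearIndependent_coe_basis b
  obtain ⟨y, rfl⟩ := DesarguesianSpread.exists_eq_segreSpace b hΨ hK hh hk hV hper hΘ hRΘ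
  have hy := DesarguesianSpread.linearIndependent_of_isDirectorSpace b hk hh hV hΘ
  obtain ⟨P, hP, rfl⟩ := hΞΘ
  have hext := hΘ.extension_spreadElement hΨ hK hV hh hper hP
  rw [hext]
  obtain ⟨x, i₀, hne, hi₀, rfl⟩ := DesarguesianSpread.exists_mk_eq b hP
  have hx₀ : x ≠ 0 := fun h0 => one_ne_zero (hi₀.symm.trans (congrFun h0 i₀))
  refine ⟨_, hΘ.submodule_eq_inf hΨ hh hper hV hP, ?_, ?_⟩
  · intro huniq
    apply Set.Subset.antisymm
    · rintro Q ⟨hQ, hQS⟩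
      by_contra hQP
      obtain ⟨m, a, hm, hmh, hxm⟩ :=
        DesarguesianSpread.exists_frob_iterate_eq_smul b hΨ hK hy hx₀ hne hQ hQS hQP
      -- The coordinate normalized to 1 is fixed by Frobenius.
      have ha : a = 1 := by
        have := hxm i₀
        rw [hi₀, mul_one, iterate_map_one] at this
        exact this.symm
      simp only [ha, one_mul] at hxm
      -- If `x` were rational, Ξ would be a member of the regulus and so meet the Segre variety over
      -- `F`.
      have hrat : ∃ i₁, DesarguesianSpread.frob F K (x i₁) ≠ x i₁ := by
        by_contra! hfix
        choose x' hx' using fun j => DesarguesianSpread.exists_algebraMap_eq_of_frob_eq (hfix j)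
        obtain rfl : (fun j => algebraMap F K (x' j)) = x := funext hx'
        have hx'₀ : x' ≠ 0 := by
          rintro rfl
          simp at hi₀
        have hS := DesarguesianSpread.spreadElement_coeSegre b hΨ hK hh hV hper hΘ hx'₀ hne
        have hone : (1 : Fin h → F) ≠ 0 := fun h0 => one_ne_zero (congrFun h0 ⟨0, hh⟩)
        have hne' := DesarguesianSpread.segreVector_ne_zero b.linearIndependent hx'₀ hone
        refine hdisj _ ⟨x', 1, hne', rfl⟩ ?_
        rw [Projectivization.submodule_mk, Submodule.span_singleton_le_iff_mem, hS]
        exact ⟨1, rfl⟩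
      obtain ⟨i₁, hi₁⟩ := hrat
      obtain ⟨Θ', hΘ', hΞ', hR', hneq⟩ := DesarguesianSpread.exists_ne_spreadOf b hΨ hK hh hk hV
        hper hΘ hne hm hmh hxm hi₀ hi₁
      apply hneq
      have hmem : DesarguesianSpread.spreadOf Ψ hΨ h Θ' ∈
          {D : Set (Submodule F (DesarguesianSpread.fixedSpace Ψ)) |
          DesarguesianSpread.IsDesarguesian Ψ hΨ k h D ∧
            DesarguesianSpread.spreadElement Ψ hΨ h (Projectivization.mk K _ hne) ∈ D ∧
            DesarguesianSpread.segreRegulus F b ⊆ D} :=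
        ⟨hΘ'.isDesarguesian hΨ hK hV hh hper, hΞ', hR'⟩
      rw [huniq] at hmem
      exact hmem
    · rintro _ ⟨i, rfl⟩
      refine ⟨DesarguesianSpread.conjPoint_le_orbitSpan hΨ hh hper i _, ?_⟩
      have hne' := DesarguesianSpread.iterate_ne_zero (i := i) Ψ hΨ hne
      rw [DesarguesianSpread.iterate_coeSegre] at hne'
      refine ⟨_, _, hne', ?_⟩
      simp only [DesarguesianSpread.conjPoint_mk, DesarguesianSpread.iterate_coeSegre]
  · intro hmeet
    refine Set.eq_singleton_iff_unique_mem.2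
      ⟨⟨hΘ.isDesarguesian hΨ hK hV hh hper, ⟨_, hP, rfl⟩, hRΘ⟩, ?_⟩
    rintro D ⟨⟨-, Φ, hΦ, g, hD⟩, hΞD, hRD⟩
    obtain ⟨Θ', hΘ', hD'⟩ := DesarguesianSpread.exists_spreadOf_eq_image b hcard hΨ hΦ g
    obtain rfl := hD.trans hD'
    obtain ⟨y', rfl⟩ := DesarguesianSpread.exists_eq_segreSpace b hΨ hK hh hk hV hper hΘ' hRD
    obtain ⟨Q, hQ, hX⟩ := hΞD
    have hext' := hΘ'.extension_spreadElement hΨ hK hV hh hper hQ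
    rw [← hX, hext] at hext'
    obtain ⟨x', j₀, hne', hj₀, rfl⟩ := DesarguesianSpread.exists_mk_eq b hQ
    have hQmem : Projectivization.mk K _ hne' ∈ Set.range fun i : Fin h =>
        DesarguesianSpread.conjPoint Ψ hΨ i (Projectivization.mk K _ hne) := by
      rw [← hmeet]
      refine ⟨?_, x', y', hne', rfl⟩
      change (Projectivization.mk K _ hne').submodule ≤ _
      rw [hext']
      exact DesarguesianSpread.conjPoint_le_orbitSpan hΨ hh hper 0 _
    obtain ⟨i, hi⟩ := hQmem
    simp only [DesarguesianSpread.conjPoint_mk] at hi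
    obtain ⟨c, hc⟩ := (Projectivization.mk_eq_mk_iff' K _ _ _ _).1 hi.symm
    rw [DesarguesianSpread.iterate_coeSegre, ← DesarguesianSpread.segreVector_smul_left] at hc
    -- The row `j₀`, where x' is 1, exhibits y' as a multiple of σ^i(y); the multiple is nonzero
    -- because x'⊗y' is.
    have hcoord := fun j => DesarguesianSpread.segreVector_inj hb hc j₀ j
    simp only [hj₀, one_mul] at hcoord
    refine DesarguesianSpread.spreadOf_segreSpace_conj b hΨ hh hper (n := i) ?_
      (funext fun j => (hcoord j).symm)
    intro h0
    apply hne'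
    have hy'₀ : y' = 0 := funext fun j => by rw [← hcoord j, h0, zero_mul]; rfl
    rw [hy'₀]
    exact DesarguesianSpread.segreVector_zero_right _ _
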